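/- Let $\mathbb F$ be an algebraically closed field and $\lambda_0\in\mathbb F$. A rational matrix $R(\lambda)$ is *defined at $\lambda_0$* if no entry, written in lowest terms, has a denominator vanishing at $\lambda_0$; a square rational matrix $R(\lambda)$ is *regular at $\lambda_0$* if it is defined at $\lambda_0$ and $\det R(\lambda_0)\neq 0$. The normal rank, $\operatorname{rank} G$, is the rank over $\mathbb F(\lambda)$. Every $G(\lambda)\in\mathbb F(\lambda)^{p\times m}$ of normal rank $r$ can be written as $R_1GR_2=\begin{bmatrix}\operatorname{diag}((\lambda-\lambda_0)^{\nu_1},\dots,(\lambda-\lambda_0)^{\nu_r})&0\\0&0\end{bmatrix}$ with $R_1,R_2$ regular at $\lambda_0$ and unique integers $\nu_1\le\dots\le\nu_r$ (the invariant orders of $G$ at $\lambda_0$). The *pole elementary divisors* of $G$ at $\lambda_0$ are the $(\lambda-\lambda_0)^{-\nu_i}$ with $\nu_i<0$, and the *zero elementary divisors* are the $(\lambda-\lambda_0)^{\nu_i}$ with $\nu_i>0$, both counted with repetitions; for a polynomial matrix the *elementary divisors* at $\lambda_0$ are the $(\lambda-\lambda_0)^{\nu_i}$ with $\nu_i\ne0$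 (then all $\nu_i\ge 0$). Let $n,q,r\ge 0$. A *linear polynomial system matrix* is a matrix $$\mathcal L(\lambda)=\begin{bmatrix}A_1\lambda+A_0&B_1\lambda+B_0\\-(C_1\lambda+C_0)&D_1\lambda+D_0\end{bmatrix}\in\mathbb F[\lambda]^{(n+q)\times(n+r)}$$ whose $n\times n$ state pencil $A(\lambda)=A_1\lambda+A_0$ satisfies $\det A(\lambda)\not\equiv0$ if $n>0$. Its transfer function matrix is $\widehat G(\lambda)=(D_1\lambda+D_0)+(C_1\lambda+C_0)(A_1\lambda+A_0)^{-1}(B_1\lambda+B_0)\in\mathbb F(\lambda)^{q\times r}$ (equal to $D_1\lambda+D_0$ if $n=0$). It is *minimal at $\lambda_0$* if $n=0$ or $$\operatorname{rank}\begin{bmatrix}A_1\lambda_0+A_0\\C_1\lambda_0+C_0\end{bmatrix}=\operatorname{rank}\begin{bmatrix}A_1\lambda_0+A_0&B_1\lambda_0+B_0\end{bmatrix}=n.$$ It is a *linearization at $\lambda_0$* of $G(\lambda)\in\mathbb F(\lambda)^{p\times m}$ if it is minimal at $\lambda_0$ and there are integers $s_1,s_2\ge0$ with $s_1-s_2=q-p=r-m$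 and rational matrices $R_1,R_2$ regular at $\lambda_0$ such that $R_1\operatorname{diag}(G,I_{s_1})R_2=\operatorname{diag}(\widehat G,I_{s_2})$. **Theorem.** Let $G(\lambda)\in\mathbb F(\lambda)^{p\times m}$, $\lambda_0\in\mathbb F$, $s\ge0$, and let $\mathcal L(\lambda)\in\mathbb F[\lambda]^{(n+(p+s))\times(n+(m+s))}$ be a linear polynomial system matrix as above (with $q=p+s$, $r=m+s$), minimal at $\lambda_0$. Then $\mathcal L(\lambda)$ is a linearization of $G(\lambda)$ at $\lambda_0$ if and only if the following three conditions hold: (a) $\operatorname{rank}\mathcal L(\lambda)=\operatorname{rank}G(\lambda)+n+s$; (b) the pole elementary divisors of $G(\lambda)$ at $\lambda_0$ are the elementary divisors of $A_1\lambda+A_0$ at $\lambda_0$; (c) the zero elementary divisors of $G(\lambda)$ at $\lambda_0$ are the elementary divisors of $\mathcal L(\lambda)$ at $\lambda_0$. -/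

import Mathlib

open Polynomial

noncomputable section

namespace RatMat

variable {F : Type*} [Field F]

/-! ### Rational matrices at a finite point -/

/-- A rational matrix is defined (bounded) at `a` if no entry, in lowest terms, has a
denominator vanishing at `a`. -/
def DefinedAt {ι κ : Type*} (R : Matrix ι κ (RatFunc F)) (a : F) : Prop :=
  ∀ i j, (R i j).denom.eval a ≠ 0

/-- The value `R(a)` of a rational matrix (meaningful if `R` is defined at `a`). -/
def evalAt {ι κ : Type*} (R : Matrix ι κ (RatFunc F)) (a : F) : Matrix ι κ F :=
  R.map (RatFunc.eval (RingHom.id F) a)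

/-- A square rational matrix is regular (invertible) at `a` if it is defined at `a` and
`det R(a) ≠ 0`. -/
def RegularAt {ι : Type*} [Fintype ι] [DecidableEq ι] (R : Matrix ι ι (RatFunc F)) (a : F) :
    Prop :=
  DefinedAt R a ∧ (evalAt R a).det ≠ 0

/-- Equivalence at `a`: `R₁ G R₂ = H` with `R₁`, `R₂` regular at `a`. -/
def EquivalentAt {ι κ : Type*} [Fintype ι] [DecidableEq ι] [Fintype κ] [DecidableEq κ]
    (G H : Matrix ι κ (RatFunc F)) (a : F) : Prop :=
  ∃ (R₁ : Matrix ι ι (RatFunc F)) (R₂ : Matrix κ κ (RatFunc F)),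
    RegularAt R₁ a ∧ RegularAt R₂ a ∧ R₁ * G * R₂ = H

/-- The `p × m` matrix `[diag((λ-a)^{ν₁}, …, (λ-a)^{ν_r}), 0; 0, 0]`, where `ν = [ν₁, …, ν_r]`. -/
def smithMcMillanForm (p m : ℕ) (a : F) (ν : List ℤ) : Matrix (Fin p) (Fin m) (RatFunc F) :=
  Matrix.of fun i j =>
    if h : i.val = j.val ∧ i.val < ν.length then
      (RatFunc.X - RatFunc.C a) ^ (ν[i.val]'h.2)
    else 0

/-- `ν = [ν₁, …, ν_r]`, `ν₁ ≤ ⋯ ≤ ν_r` with `r` the normal rank of `G`, is the list of exponents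
of a local Smith–McMillan form of `G` at `a`. -/
def IsInvariantOrders {p m : ℕ} (G : Matrix (Fin p) (Fin m) (RatFunc F)) (a : F)
    (ν : List ℤ) : Prop :=
  ν.Pairwise (· ≤ ·) ∧ ν.length = G.rank ∧ EquivalentAt G (smithMcMillanForm p m a ν) a

/-! ### Existence of the local Smith–McMillan form -/

/-- `x` is defined at `a`. -/
def Def1 (a : F) (x : RatFunc F) : Prop := x.denom.eval a ≠ 0

theorem def1_div (a : F) (p q : F[X]) (hq : q.eval a ≠ 0) :
    Def1 a (algebraMap F[X] (RatFunc F) p / algebraMap F[X] (RatFunc F) q) := by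
  intro h
  have hd := RatFunc.denom_div_dvd p q
  exact hq (Polynomial.eval_eq_zero_of_dvd_of_eval_eq_zero hd h)

theorem def1_iff (a : F) (x : RatFunc F) :
    Def1 a x ↔ ∃ p q : F[X], q.eval a ≠ 0 ∧
      x = algebraMap F[X] (RatFunc F) p / algebraMap F[X] (RatFunc F) q := by
  constructor
  · intro h
    exact ⟨x.num, x.denom, h, (RatFunc.num_div_denom x).symm⟩
  · rintro ⟨p, q, hq, rfl⟩
    exact def1_div a p q hq

theorem algMap_ne {a : F} {q : F[X]} (hq : q.eval a ≠ 0) :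
    algebraMap F[X] (RatFunc F) q ≠ 0 := by
  rw [Ne, map_eq_zero_iff _ (RatFunc.algebraMap_injective F)]
  rintro rfl
  simp at hq

theorem def1_poly (a : F) (p : F[X]) : Def1 a (algebraMap F[X] (RatFunc F) p) := by
  have := def1_div a p 1 (by simp)
  simpa using this

theorem def1_zero (a : F) : Def1 a (0 : RatFunc F) := by simpa using def1_poly a 0

theorem def1_one (a : F) : Def1 a (1 : RatFunc F) := by simpa using def1_poly a 1

theorem def1_add {a : F} {x y : RatFunc F} (hx : Def1 a x) (hy : Def1 a y) :
    Def1 a (x + y) := by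
  rw [def1_iff] at *
  obtain ⟨p, q, hq, rfl⟩ := hx
  obtain ⟨p', q', hq', rfl⟩ := hy
  refine ⟨p * q' + q * p', q * q', by simp [hq, hq'], ?_⟩
  rw [div_add_div _ _ (algMap_ne hq) (algMap_ne hq')]
  simp

theorem def1_mul {a : F} {x y : RatFunc F} (hx : Def1 a x) (hy : Def1 a y) :
    Def1 a (x * y) := by
  rw [def1_iff] at *
  obtain ⟨p, q, hq, rfl⟩ := hx
  obtain ⟨p', q', hq', rfl⟩ := hy
  refine ⟨p * p', q * q', by simp [hq, hq'], ?_⟩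
  rw [div_mul_div_comm]
  simp

theorem def1_neg {a : F} {x : RatFunc F} (hx : Def1 a x) : Def1 a (-x) := by
  have := def1_mul (def1_poly a (-1)) hx
  simpa using this

theorem def1_sum {a : F} {ι : Type*} (s : Finset ι) (f : ι → RatFunc F)
    (h : ∀ i ∈ s, Def1 a (f i)) : Def1 a (∑ i ∈ s, f i) :=
  Finset.sum_induction f (Def1 a) (fun _ _ => def1_add) (def1_zero a) h

theorem eval_sum {a : F} {ι : Type*} (s : Finset ι) (f : ι → RatFunc F)
    (h : ∀ i ∈ s, Def1 a (f i)) :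
    RatFunc.eval (RingHom.id F) a (∑ i ∈ s, f i) =
      ∑ i ∈ s, RatFunc.eval (RingHom.id F) a (f i) := by
  classical
  induction s using Finset.induction_on with
  | empty => simp
  | insert i s hi ih =>
    rw [Finset.sum_insert hi, Finset.sum_insert hi, RatFunc.eval_add, ih]
    · exact fun j hj => h j (Finset.mem_insert_of_mem hj)
    · exact h i (Finset.mem_insert_self _ _)
    · exact def1_sum s f fun j hj => h j (Finset.mem_insert_of_mem hj)

/-- The uniformizer `λ - a`. -/
def unif (a : F) : RatFunc F := RatFunc.X - RatFunc.C a

theorem unif_eq (a : F) : unif a = algebraMap F[X] (RatFunc F) (X - C a) := by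
  simp [unif]

theorem unif_ne (a : F) : unif a ≠ 0 := by
  rw [unif_eq, Ne, map_eq_zero_iff _ (RatFunc.algebraMap_injective F)]
  exact X_sub_C_ne_zero a

theorem def1_unif_zpow (a : F) {k : ℤ} (hk : 0 ≤ k) : Def1 a (unif a ^ k) := by
  lift k to ℕ using hk
  rw [zpow_natCast, unif_eq, ← map_pow]
  exact def1_poly a _

theorem factor (a : F) {x : RatFunc F} (hx : x ≠ 0) :
    ∃ (k : ℤ) (u : RatFunc F), u ≠ 0 ∧ Def1 a u ∧ Def1 a u⁻¹ ∧ x = unif a ^ k * u := by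
  have hn : x.num ≠ 0 := RatFunc.num_ne_zero hx
  have hd : x.denom ≠ 0 := RatFunc.denom_ne_zero x
  obtain ⟨p, hp, hp'⟩ := Polynomial.exists_eq_pow_rootMultiplicity_mul_and_not_dvd _ hn a
  obtain ⟨q, hq, hq'⟩ := Polynomial.exists_eq_pow_rootMultiplicity_mul_and_not_dvd _ hd a
  rw [Polynomial.dvd_iff_isRoot, Polynomial.IsRoot] at hp' hq'
  refine ⟨(x.num.rootMultiplicity a : ℤ) - x.denom.rootMultiplicity a,
    algebraMap _ _ p / algebraMap _ _ q, div_ne_zero (algMap_ne hp') (algMap_ne hq'),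
    def1_div a p q hq', by rw [inv_div]; exact def1_div a q p hp', ?_⟩
  conv_lhs => rw [← RatFunc.num_div_denom x, hp, hq]
  rw [zpow_sub₀ (unif_ne a), map_mul, map_mul, map_pow, map_pow, ← unif_eq, zpow_natCast,
    zpow_natCast, div_mul_div_comm]

section Mat

variable {ι κ μ : Type*} [Fintype ι] [DecidableEq ι] [Fintype κ] [DecidableEq κ]
  {a : F}

theorem definedAt_mul {M : Matrix μ ι (RatFunc F)} {N : Matrix ι κ (RatFunc F)}
    (hM : DefinedAt M a) (hN : DefinedAt N a) : DefinedAt (M * N) a := by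
  intro i j
  rw [Matrix.mul_apply]
  exact def1_sum _ _ fun k _ => def1_mul (hM i k) (hN k j)

theorem evalAt_mul {M : Matrix μ ι (RatFunc F)} {N : Matrix ι κ (RatFunc F)}
    (hM : DefinedAt M a) (hN : DefinedAt N a) : evalAt (M * N) a = evalAt M a * evalAt N a := by
  ext i j
  simp only [evalAt, Matrix.map_apply, Matrix.mul_apply]
  rw [eval_sum _ _ fun k _ => def1_mul (hM i k) (hN k j)]
  exact Finset.sum_congr rfl fun k _ => RatFunc.eval_mul (f := RingHom.id F) (a := a)
    (x := M i k) (y := N k j) (hM i k) (hN k j)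

theorem definedAt_one : DefinedAt (1 : Matrix ι ι (RatFunc F)) a := by
  intro i j
  rw [Matrix.one_apply]
  split_ifs
  · exact def1_one a
  · exact def1_zero a

theorem evalAt_one : evalAt (1 : Matrix ι ι (RatFunc F)) a = 1 := by
  ext i j
  simp only [evalAt, Matrix.map_apply, Matrix.one_apply]
  split_ifs <;> simp

theorem regularAt_of_mul {M N : Matrix ι ι (RatFunc F)} (hM : DefinedAt M a)
    (hN : DefinedAt N a) (h : M * N = 1) : RegularAt M a := by
  refine ⟨hM, fun h0 => ?_⟩
  have := congrArg Matrix.det (evalAt_mul hM hN)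
  rw [h, evalAt_one, Matrix.det_mul, h0] at this
  simp at this

theorem RegularAt.mul {M N : Matrix ι ι (RatFunc F)} (hM : RegularAt M a)
    (hN : RegularAt N a) : RegularAt (M * N) a :=
  ⟨definedAt_mul hM.1 hN.1, by
    rw [evalAt_mul hM.1 hN.1, Matrix.det_mul]
    exact mul_ne_zero hM.2 hN.2⟩

theorem regularAt_one : RegularAt (1 : Matrix ι ι (RatFunc F)) a :=
  regularAt_of_mul definedAt_one definedAt_one (one_mul 1)

theorem RegularAt.submatrix {M : Matrix ι ι (RatFunc F)} (hM : RegularAt M a) (e : κ ≃ ι) :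
    RegularAt (M.submatrix e e) a :=
  ⟨fun i j => hM.1 _ _, by
    have : evalAt (M.submatrix e e) a = (evalAt M a).submatrix e e := rfl
    rw [this, Matrix.det_submatrix_equiv_self]
    exact hM.2⟩

theorem RegularAt.fromBlocks_one {M : Matrix ι ι (RatFunc F)} (hM : RegularAt M a) :
    RegularAt (Matrix.fromBlocks (1 : Matrix κ κ (RatFunc F)) 0 0 M) a := by
  refine ⟨?_, ?_⟩
  · rintro (i | i) (j | j)
    · exact definedAt_one i j
    · exact def1_zero a
    · exact def1_zero a
    · exact hM.1 i j
  · have : evalAt (Matrix.fromBlocks (1 : Matrix κ κ (RatFunc F)) 0 0 M) a =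
        Matrix.fromBlocks 1 0 0 (evalAt M a) := by
      rw [← evalAt_one (a := a), evalAt, Matrix.fromBlocks_map]
      congr 1 <;> ext <;> simp
    rw [this, Matrix.det_fromBlocks_zero₂₁]
    simpa using hM.2

theorem EquivalentAt.refl (G : Matrix ι κ (RatFunc F)) : EquivalentAt G G a :=
  ⟨1, 1, regularAt_one, regularAt_one, by simp⟩

theorem EquivalentAt.trans {G H K : Matrix ι κ (RatFunc F)} (h : EquivalentAt G H a)
    (h' : EquivalentAt H K a) : EquivalentAt G K a := by
  obtain ⟨R, S, hR, hS, rfl⟩ := h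
  obtain ⟨R', S', hR', hS', rfl⟩ := h'
  exact ⟨R' * R, S * S', hR'.mul hR, hS.mul hS', by simp only [Matrix.mul_assoc]⟩

theorem regularAt_perm (e : ι ≃ ι) :
    RegularAt ((1 : Matrix ι ι (RatFunc F)).submatrix e id) a := by
  refine regularAt_of_mul (N := (1 : Matrix ι ι (RatFunc F)).submatrix id e)
    (fun i j => definedAt_one _ _) (fun i j => definedAt_one _ _) ?_
  have := Matrix.submatrix_mul (1 : Matrix ι ι (RatFunc F)) (1 : Matrix ι ι (RatFunc F))
    e id e Function.bijective_id
  rw [← this, mul_one]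
  exact Matrix.submatrix_one_equiv e

theorem equivalentAt_perm (G : Matrix ι κ (RatFunc F)) (e : ι ≃ ι) (f : κ ≃ κ) :
    EquivalentAt G (G.submatrix e f) a := by
  refine ⟨_, (1 : Matrix κ κ (RatFunc F)).submatrix id f, regularAt_perm e, ?_, ?_⟩
  · refine regularAt_of_mul (N := (1 : Matrix κ κ (RatFunc F)).submatrix f id)
      (fun i j => definedAt_one _ _) (fun i j => definedAt_one _ _) ?_
    have := Matrix.submatrix_mul_equiv (1 : Matrix κ κ (RatFunc F))
      (1 : Matrix κ κ (RatFunc F)) id f id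
    rw [this, mul_one]
    exact Matrix.submatrix_one_equiv (Equiv.refl κ)
  · have h1 := Matrix.submatrix_mul (1 : Matrix ι ι (RatFunc F)) G e id id
      Function.bijective_id
    have h2 := Matrix.submatrix_mul G (1 : Matrix κ κ (RatFunc F)) e id f
      Function.bijective_id
    rw [Matrix.one_mul] at h1
    rw [Matrix.mul_one] at h2
    have h3 : G.submatrix id id = G := rfl
    rw [h2, h1, h3]

theorem EquivalentAt.reindex {ι' κ' : Type*} [Fintype ι'] [DecidableEq ι'] [Fintype κ']
    [DecidableEq κ'] {G H : Matrix ι κ (RatFunc F)} (h : EquivalentAt G H a) (e : ι' ≃ ι)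
    (f : κ' ≃ κ) : EquivalentAt (G.submatrix e f) (H.submatrix e f) a := by
  obtain ⟨R, S, hR, hS, rfl⟩ := h
  refine ⟨R.submatrix e e, S.submatrix f f, hR.submatrix e, hS.submatrix f, ?_⟩
  rw [Matrix.submatrix_mul_equiv, Matrix.submatrix_mul_equiv]

theorem EquivalentAt.fromBlocks {ι' κ' : Type*} [Fintype ι'] [DecidableEq ι'] [Fintype κ']
    [DecidableEq κ'] {G H : Matrix ι κ (RatFunc F)} (h : EquivalentAt G H a)
    (T : Matrix ι' κ' (RatFunc F)) :
    EquivalentAt (Matrix.fromBlocks T 0 0 G) (Matrix.fromBlocks T 0 0 H) a := by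
  obtain ⟨R, S, hR, hS, rfl⟩ := h
  refine ⟨_, _, hR.fromBlocks_one (κ := ι'), hS.fromBlocks_one (κ := κ'), ?_⟩
  simp [Matrix.fromBlocks_multiply]

/-- One elimination step with pivot `t * u`, where `u` is a unit at `a`. -/
theorem equivalentAt_pivot (t u : RatFunc F) (ht : t ≠ 0) (hu : u ≠ 0) (hu' : Def1 a u)
    (hui : Def1 a u⁻¹)
    (b : Matrix Unit κ (RatFunc F)) (c : Matrix ι Unit (RatFunc F)) (d : Matrix ι κ (RatFunc F))
    (hb : ∀ j, Def1 a (t⁻¹ * b () j)) (hc : ∀ i, Def1 a (t⁻¹ * c i ())) :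
    EquivalentAt (Matrix.fromBlocks (Matrix.of fun _ _ => t * u) b c d)
      (Matrix.fromBlocks (Matrix.of fun _ _ => t) 0 0
        (Matrix.of fun i j => d i j - (t * u)⁻¹ * c i () * b () j)) a := by
  refine ⟨Matrix.fromBlocks (Matrix.of fun _ _ => u⁻¹) 0
      (Matrix.of fun i _ => -(u⁻¹ * (t⁻¹ * c i ()))) 1,
    Matrix.fromBlocks 1 (Matrix.of fun _ j => -(u⁻¹ * (t⁻¹ * b () j))) 0 1, ?_, ?_, ?_⟩
  · refine regularAt_of_mul (N := Matrix.fromBlocks (Matrix.of fun _ _ => u) 0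
      (Matrix.of fun i _ => t⁻¹ * c i ()) 1) ?_ ?_ ?_
    · rintro (i | i) (j | j)
      · exact hui
      · exact def1_zero a
      · exact def1_neg (def1_mul hui (hc i))
      · exact definedAt_one i j
    · rintro (i | i) (j | j)
      · exact hu'
      · exact def1_zero a
      · exact hc i
      · exact definedAt_one i j
    · rw [Matrix.fromBlocks_multiply, ← Matrix.fromBlocks_one]
      simp only [Matrix.mul_one, Matrix.one_mul, Matrix.mul_zero, Matrix.zero_mul, add_zero,
        zero_add]
      congr 1
      · ext i j
        simp [Matrix.mul_apply, hu]
      · ext i j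
        simp [Matrix.mul_apply]
        field_simp
        ring
  · refine regularAt_of_mul (N := Matrix.fromBlocks 1
      (Matrix.of fun _ j => (u⁻¹ * (t⁻¹ * b () j))) 0 1) ?_ ?_ ?_
    · rintro (i | i) (j | j)
      · exact definedAt_one i j
      · exact def1_neg (def1_mul hui (hb j))
      · exact def1_zero a
      · exact definedAt_one i j
    · rintro (i | i) (j | j)
      · exact definedAt_one i j
      · exact def1_mul hui (hb j)
      · exact def1_zero a
      · exact definedAt_one i j
    · rw [Matrix.fromBlocks_multiply, ← Matrix.fromBlocks_one]
      simp only [Matrix.mul_one, Matrix.one_mul, Matrix.mul_zero, Matrix.zero_mul, add_zero,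
        zero_add]
      congr 1
      ext i j
      simp
  · rw [Matrix.fromBlocks_multiply, Matrix.fromBlocks_multiply]
    simp only [Matrix.mul_one, Matrix.one_mul, Matrix.mul_zero, Matrix.zero_mul, add_zero,
      zero_add]
    congr 1
    · ext i j
      simp [Matrix.mul_apply]
      field_simp
    · ext i j
      simp [Matrix.mul_apply]
      field_simp
      ring
    · ext i j
      simp [Matrix.mul_apply]
      field_simp
      ring
    · ext i j
      simp [Matrix.mul_apply]
      field_simp
      ring

end Mat

/-- `Fin (p + 1)` as first index plus remaining indices. -/
def finSplit (p : ℕ) : Fin (p + 1) ≃ Unit ⊕ Fin p :=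
  (finSuccEquiv p).trans ((Equiv.optionEquivSumPUnit (Fin p)).trans (Equiv.sumComm _ _))

theorem finSplit_zero (p : ℕ) : finSplit p 0 = Sum.inl () := by
  simp [finSplit]

theorem finSplit_succ (p : ℕ) (i : Fin p) : finSplit p i.succ = Sum.inr i := by
  simp [finSplit]

theorem smithMcMillanForm_nil (p m : ℕ) (a : F) : smithMcMillanForm p m a [] = 0 := by
  ext i j
  simp [smithMcMillanForm]

theorem smithMcMillanForm_cons (p m : ℕ) (a : F) (k : ℤ) (ν : List ℤ) :
    smithMcMillanForm (p + 1) (m + 1) a (k :: ν) =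
      (Matrix.fromBlocks (Matrix.of fun _ _ => unif a ^ k) 0 0
        (smithMcMillanForm p m a ν)).submatrix (finSplit p) (finSplit m) := by
  ext i j
  refine Fin.cases ?_ (fun i => ?_) i <;> refine Fin.cases ?_ (fun j => ?_) j
  · simp [smithMcMillanForm, finSplit_zero, unif]
  · simp [smithMcMillanForm, finSplit_zero, finSplit_succ]
  · simp [smithMcMillanForm, finSplit_zero, finSplit_succ]
  · simp [smithMcMillanForm, finSplit_succ]

theorem exists_equivalentAt_smithMcMillanForm (a : F) (p : ℕ) : ∀ (m : ℕ)
    (G : Matrix (Fin p) (Fin m) (RatFunc F)) (k₀ : ℤ),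
    (∀ i j, Def1 a (unif a ^ (-k₀) * G i j)) →
    ∃ ν : List ℤ, ν.Pairwise (· ≤ ·) ∧ (∀ k ∈ ν, k₀ ≤ k) ∧ ν.length ≤ p ∧ ν.length ≤ m ∧
      EquivalentAt G (smithMcMillanForm p m a ν) a := by
  induction p with
  | zero =>
    intro m G k₀ _
    refine ⟨[], by simp, by simp, by simp, by simp, ?_⟩
    rw [Subsingleton.elim G (smithMcMillanForm 0 m a [])]
    exact EquivalentAt.refl _
  | succ p ih =>
    intro m G k₀ hk₀
    by_cases hG : G = 0
    · refine ⟨[], by simp, by simp, by simp, by simp, ?_⟩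
      rw [hG, smithMcMillanForm_nil]
      exact EquivalentAt.refl _
    cases m with
    | zero => exact absurd (Subsingleton.elim G 0) hG
    | succ m =>
      -- a nonzero entry of minimal order at `a`
      have hfac : ∀ x : Fin (p + 1) × Fin (m + 1), ∃ (k : ℤ) (u : RatFunc F), u ≠ 0 ∧
          Def1 a u ∧ Def1 a u⁻¹ ∧ (G x.1 x.2 ≠ 0 → G x.1 x.2 = unif a ^ k * u) := by
        intro x
        by_cases h : G x.1 x.2 = 0
        · exact ⟨0, 1, one_ne_zero, def1_one a, by simpa using def1_one a, fun h' => absurd h h'⟩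
        · obtain ⟨k, u, h1, h2, h3, h4⟩ := factor a h
          exact ⟨k, u, h1, h2, h3, fun _ => h4⟩
      choose ord un hun hund huni hord using hfac
      classical
      have hne : (Finset.univ.filter fun x : Fin (p + 1) × Fin (m + 1) =>
          G x.1 x.2 ≠ 0).Nonempty := by
        by_contra hcon
        rw [Finset.not_nonempty_iff_eq_empty, Finset.filter_eq_empty_iff] at hcon
        apply hG
        ext i j
        simpa using hcon (Finset.mem_univ (i, j))
      obtain ⟨x₀, hx₀, hmin⟩ := Finset.exists_min_image _ ord hne
      rw [Finset.mem_filter] at hx₀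
      set k := ord x₀ with hk
      have hall : ∀ i j, Def1 a (unif a ^ (-k) * G i j) := by
        intro i j
        by_cases h : G i j = 0
        · rw [h, mul_zero]
          exact def1_zero a
        · rw [hord (i, j) h, ← mul_assoc, ← zpow_add₀ (unif_ne a)]
          refine def1_mul (def1_unif_zpow a ?_) (hund _)
          have := hmin (i, j) (by simpa using h)
          omega
      have hk₀k : k₀ ≤ k := by
        by_contra hlt
        push Not at hlt
        have h1 := hk₀ x₀.1 x₀.2
        rw [hord x₀ hx₀.2, ← hk, ← mul_assoc, ← zpow_add₀ (unif_ne a)] at h1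
        have h2 := def1_mul (def1_mul h1 (huni x₀))
          (def1_unif_zpow a (k := k₀ - k - 1) (by omega))
        have h3 : unif a ^ (-k₀ + k) * un x₀ * (un x₀)⁻¹ * unif a ^ (k₀ - k - 1) =
            (unif a)⁻¹ := by
          rw [mul_assoc (unif a ^ (-k₀ + k)), mul_inv_cancel₀ (hun x₀), mul_one,
            ← zpow_add₀ (unif_ne a), ← zpow_neg_one]
          congr 1
          ring
        rw [h3, def1_iff] at h2
        obtain ⟨P, Q, hQ, hPQ⟩ := h2
        rw [unif_eq, eq_div_iff (algMap_ne hQ), inv_mul_eq_iff_eq_mul₀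
          (by rw [← unif_eq]; exact unif_ne a), ← map_mul] at hPQ
        have h4 := RatFunc.algebraMap_injective F hPQ
        rw [h4] at hQ
        simp at hQ
      -- move the pivot to the corner and eliminate
      let e : Fin (p + 1) ≃ Fin (p + 1) := Equiv.swap 0 x₀.1
      let f : Fin (m + 1) ≃ Fin (m + 1) := Equiv.swap 0 x₀.2
      let G' : Matrix (Fin (p + 1)) (Fin (m + 1)) (RatFunc F) := G.submatrix e f
      let b : Matrix Unit (Fin m) (RatFunc F) := Matrix.of fun _ j => G' 0 j.succ
      let c : Matrix (Fin p) Unit (RatFunc F) := Matrix.of fun i _ => G' i.succ 0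
      let d : Matrix (Fin p) (Fin m) (RatFunc F) := Matrix.of fun i j => G' i.succ j.succ
      have hG' : G' = (Matrix.fromBlocks (Matrix.of fun _ _ => unif a ^ k * un x₀) b c
          d).submatrix (finSplit p) (finSplit m) := by
        ext i j
        refine Fin.cases ?_ (fun i => ?_) i <;> refine Fin.cases ?_ (fun j => ?_) j
        · have : G' 0 0 = G x₀.1 x₀.2 := by simp [G', e, f]
          rw [this, hord x₀ hx₀.2]
          simp [finSplit_zero, hk]
        · simp [finSplit_zero, finSplit_succ, b]
        · simp [finSplit_zero, finSplit_succ, c]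
        · simp [finSplit_succ, d]
      have hall' : ∀ i j, Def1 a (unif a ^ (-k) * G' i j) := fun i j => hall _ _
      have htk : unif a ^ k ≠ 0 := zpow_ne_zero _ (unif_ne a)
      have hpiv := equivalentAt_pivot (a := a) (unif a ^ k) (un x₀) htk (hun x₀) (hund x₀)
        (huni x₀) b c d
        (fun j => by rw [← zpow_neg]; exact hall' _ _)
        (fun i => by rw [← zpow_neg]; exact hall' _ _)
      obtain ⟨ν, hν1, hν2, hν3, hν4, hν5⟩ := ih m
        (Matrix.of fun i j => d i j - (unif a ^ k * un x₀)⁻¹ * c i () * b () j) k (by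
          intro i j
          have h1 := hall' i.succ j.succ
          have h2 := def1_neg (def1_mul (huni x₀) (def1_mul (hall' i.succ 0) (hall' 0 j.succ)))
          have h3 := def1_add h1 h2
          refine (congrArg (Def1 a) ?_).mp h3
          simp only [Matrix.of_apply, b, c, d, zpow_neg]
          rw [mul_inv]
          ring)
      refine ⟨k :: ν, List.pairwise_cons.mpr ⟨hν2, hν1⟩, ?_, by simpa using hν3,
        by simpa using hν4, ?_⟩
      · intro l hl
        rcases List.mem_cons.mp hl with rfl | hl
        · exact hk₀k
        · exact hk₀k.trans (hν2 l hl)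
      · rw [smithMcMillanForm_cons]
        refine (equivalentAt_perm G e f).trans ?_
        change EquivalentAt G' _ a
        rw [hG']
        exact (hpiv.trans (hν5.fromBlocks _)).reindex _ _

theorem rank_smithMcMillanForm (p m : ℕ) (a : F) (ν : List ℤ) (hp : ν.length ≤ p)
    (hm : ν.length ≤ m) : (smithMcMillanForm p m a ν).rank = ν.length := by
  apply le_antisymm
  · have h := Matrix.rank_le_card_of_support_subset (smithMcMillanForm p m a ν)
      (Finset.univ.image (Fin.castLE hp)) (by
        intro i hi
        by_contra hcon
        apply hi
        have hi' : ¬ i.val < ν.length := by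
          intro hlt
          apply hcon
          simp only [Finset.coe_image, Finset.coe_univ, Set.image_univ, Set.mem_range]
          exact ⟨⟨i.val, hlt⟩, rfl⟩
        funext j
        simp [Matrix.row, smithMcMillanForm, hi'])
    refine h.trans (Finset.card_image_le.trans ?_)
    simp
  · have h := Matrix.rank_submatrix_le (smithMcMillanForm p m a ν) (Fin.castLE hp)
      (Fin.castLE hm)
    have hd : (smithMcMillanForm p m a ν).submatrix (Fin.castLE hp) (Fin.castLE hm) =
        Matrix.diagonal fun i : Fin ν.length => unif a ^ ν[i] := by
      ext i j
      by_cases hij : i = j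
      · subst hij
        simp [smithMcMillanForm, unif]
      · have : i.val ≠ j.val := fun h => hij (Fin.ext h)
        simp [smithMcMillanForm, hij, this]
    have hr : (Matrix.diagonal fun i : Fin ν.length => unif a ^ ν[i]).rank = ν.length := by
      rw [Matrix.rank_of_det_ne_zero]
      · simp
      · rw [Matrix.det_diagonal, Finset.prod_ne_zero_iff]
        exact fun i _ => zpow_ne_zero _ (unif_ne a)
    rwa [hd, hr] at h

/-- The ring of rational functions defined at `a`. -/
def localRing (a : F) : Subring (RatFunc F) where
  carrier := {x | Def1 a x}
  mul_mem' := def1_mul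
  one_mem' := def1_one a
  add_mem' := def1_add
  zero_mem' := def1_zero a
  neg_mem' := def1_neg

/-- Evaluation at `a`, as a ring homomorphism. -/
def localEval (a : F) : localRing a →+* F where
  toFun x := RatFunc.eval (RingHom.id F) a x.1
  map_one' := RatFunc.eval_one _ _
  map_mul' x y := RatFunc.eval_mul (f := RingHom.id F) (a := a) x.2 y.2
  map_zero' := RatFunc.eval_zero _ _
  map_add' x y := RatFunc.eval_add (f := RingHom.id F) (a := a) x.2 y.2

theorem RegularAt.det_ne_zero {ι : Type*} [Fintype ι] [DecidableEq ι] {a : F}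
    {R : Matrix ι ι (RatFunc F)} (hR : RegularAt R a) : R.det ≠ 0 := by
  let N : Matrix ι ι (localRing a) := Matrix.of fun i j => ⟨R i j, hR.1 i j⟩
  have h1 : (localRing a).subtype.mapMatrix N = R := rfl
  have h2 : (localEval a).mapMatrix N = evalAt R a := rfl
  intro h
  rw [← h1, ← RingHom.map_det] at h
  have h3 : N.det = 0 := Subtype.ext h
  apply hR.2
  rw [← h2, ← RingHom.map_det, h3, map_zero]

theorem EquivalentAt.rank_eq {ι κ : Type*} [Fintype ι] [DecidableEq ι] [Fintype κ]
    [DecidableEq κ] {G H : Matrix ι κ (RatFunc F)} {a : F} (h : EquivalentAt G H a) :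
    G.rank = H.rank := by
  obtain ⟨R, S, hR, hS, rfl⟩ := h
  rw [Matrix.rank_mul_eq_left_of_det_ne_zero _ _ hS.det_ne_zero,
    Matrix.rank_mul_eq_right_of_det_ne_zero _ _ hR.det_ne_zero]

/-- Every rational matrix has a local Smith–McMillan form at every point. -/
theorem exists_isInvariantOrders {p m : ℕ} (G : Matrix (Fin p) (Fin m) (RatFunc F)) (a : F) :
    ∃ ν : List ℤ, IsInvariantOrders G a ν := by
  have hx : ∀ x : RatFunc F, ∃ k : ℤ, ∀ l ≤ k, Def1 a (unif a ^ (-l) * x) := by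
    intro x
    by_cases h : x = 0
    · refine ⟨0, fun l _ => ?_⟩
      rw [h, mul_zero]
      exact def1_zero a
    · obtain ⟨k, u, -, hu, -, rfl⟩ := factor a h
      refine ⟨k, fun l hl => ?_⟩
      rw [← mul_assoc, ← zpow_add₀ (unif_ne a)]
      exact def1_mul (def1_unif_zpow a (by omega)) hu
  choose k hk using hx
  obtain ⟨k₀, hk₀⟩ := (Set.finite_range fun x : Fin p × Fin m => k (G x.1 x.2)).bddBelow
  obtain ⟨ν, h1, -, h2, h3, h4⟩ := exists_equivalentAt_smithMcMillanForm a p m G k₀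
    fun i j => hk _ _ (hk₀ ⟨(i, j), rfl⟩)
  exact ⟨ν, h1, by rw [h4.rank_eq, rank_smithMcMillanForm p m a ν h2 h3], h4⟩

/-! ### Invariant orders and elementary divisors -/

/-- The invariant orders `ν₁ ≤ ⋯ ≤ ν_r` at `a` of the rational matrix `G`: the exponents of its
local Smith–McMillan form at `a`. -/
def invariantOrders {p m : ℕ} (G : Matrix (Fin p) (Fin m) (RatFunc F)) (a : F) : List ℤ :=
  (exists_isInvariantOrders G a).choose

/-- The pole elementary divisors `(λ-a)^{-ν_i}`, `ν_i < 0`, of `G` at `a`, with repetitions. -/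
def poleElementaryDivisors {p m : ℕ} (G : Matrix (Fin p) (Fin m) (RatFunc F)) (a : F) :
    Multiset F[X] :=
  (((invariantOrders G a).filter (· < 0)).map fun k => (X - C a) ^ (-k).toNat : List F[X])

/-- The zero elementary divisors `(λ-a)^{ν_i}`, `ν_i > 0`, of `G` at `a`, with repetitions. -/
def zeroElementaryDivisors {p m : ℕ} (G : Matrix (Fin p) (Fin m) (RatFunc F)) (a : F) :
    Multiset F[X] :=
  (((invariantOrders G a).filter (0 < ·)).map fun k => (X - C a) ^ k.toNat : List F[X])

/-- A polynomial matrix regarded as a rational matrix. -/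
def toRat {ι κ : Type*} (P : Matrix ι κ F[X]) : Matrix ι κ (RatFunc F) :=
  P.map (algebraMap F[X] (RatFunc F))

/-- The elementary divisors `(λ-a)^{ν_i}`, `ν_i ≠ 0`, at `a` of a polynomial matrix, with
repetitions (all invariant orders of a polynomial matrix are nonnegative). -/
def elementaryDivisors {p m : ℕ} (P : Matrix (Fin p) (Fin m) F[X]) (a : F) : Multiset F[X] :=
  (((invariantOrders (toRat P) a).filter (· ≠ 0)).map fun k => (X - C a) ^ k.toNat : List F[X])

/-! ### Linear polynomial system matrices and linearizations -/

/-- The pencil `M₁ λ + M₀`. -/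
def pencil {ι κ : Type*} (M₁ M₀ : Matrix ι κ F) : Matrix ι κ F[X] :=
  Matrix.of fun i j => C (M₁ i j) * X + C (M₀ i j)

/-- The `(k+s) × (l+s)` matrix `diag(G, I_s)`. -/
def diagId {k l : ℕ} (G : Matrix (Fin k) (Fin l) (RatFunc F)) (s : ℕ) :
    Matrix (Fin (k + s)) (Fin (l + s)) (RatFunc F) :=
  (Matrix.fromBlocks G 0 0 (1 : Matrix (Fin s) (Fin s) (RatFunc F))).submatrix
    finSumFinEquiv.symm finSumFinEquiv.symm

variable (F) in
/-- A linear polynomial system matrix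
`[A₁λ+A₀, B₁λ+B₀; -(C₁λ+C₀), D₁λ+D₀]` of size `(n+q) × (n+r)`: the state matrix `A₁λ+A₀` is
nonsingular, i.e. its determinant is not the zero polynomial (automatic for `n = 0`). -/
structure LinearSystemMatrix (n q r : ℕ) where
  A₁ : Matrix (Fin n) (Fin n) F
  A₀ : Matrix (Fin n) (Fin n) F
  B₁ : Matrix (Fin n) (Fin r) F
  B₀ : Matrix (Fin n) (Fin r) F
  C₁ : Matrix (Fin q) (Fin n) F
  C₀ : Matrix (Fin q) (Fin n) F
  D₁ : Matrix (Fin q) (Fin r) F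
  D₀ : Matrix (Fin q) (Fin r) F
  nonsingular : (pencil A₁ A₀).det ≠ 0

namespace LinearSystemMatrix

variable {n q r : ℕ}

/-- The state matrix `A₁λ + A₀`. -/
def stateMatrix (L : LinearSystemMatrix F n q r) : Matrix (Fin n) (Fin n) F[X] :=
  pencil L.A₁ L.A₀

/-- The whole matrix `𝓛(λ)`. -/
def toMatrix (L : LinearSystemMatrix F n q r) : Matrix (Fin (n + q)) (Fin (n + r)) F[X] :=
  (Matrix.fromBlocks (pencil L.A₁ L.A₀) (pencil L.B₁ L.B₀)
    (-pencil L.C₁ L.C₀) (pencil L.D₁ L.D₀)).submatrix finSumFinEquiv.symm finSumFinEquiv.symm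

/-- The transfer function matrix `(D₁λ+D₀) + (C₁λ+C₀)(A₁λ+A₀)⁻¹(B₁λ+B₀)`. -/
def transferFunction (L : LinearSystemMatrix F n q r) : Matrix (Fin q) (Fin r) (RatFunc F) :=
  toRat (pencil L.D₁ L.D₀) +
    toRat (pencil L.C₁ L.C₀) * (toRat (pencil L.A₁ L.A₀))⁻¹ * toRat (pencil L.B₁ L.B₀)

/-- Minimality at `a`: `rank [A(a); C(a)] = rank [A(a), B(a)] = n`, where `A(a) = a A₁ + A₀` etc.
For `n = 0` both equalities hold automatically. -/
def IsMinimalAt (L : LinearSystemMatrix F n q r) (a : F) : Prop :=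
  (Matrix.fromRows (a • L.A₁ + L.A₀) (a • L.C₁ + L.C₀)).rank = n ∧
    (Matrix.fromCols (a • L.A₁ + L.A₀) (a • L.B₁ + L.B₀)).rank = n

/-- `𝓛` is a linearization at `a` of the `p × m` rational matrix `G`: it is minimal at `a`, and
`R₁ diag(G, I_{s₁}) R₂ = diag(Ĝ, I_{s₂})` for some `s₁, s₂ ≥ 0` with `s₁ - s₂ = q - p = r - m`
(so that the sizes on both sides agree) and some `R₁`, `R₂` regular at `a`, where `Ĝ` is the
transfer function matrix of `𝓛`. -/
def IsLinearizationAt {p m : ℕ} (L : LinearSystemMatrix F n q r)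
    (G : Matrix (Fin p) (Fin m) (RatFunc F)) (a : F) : Prop :=
  L.IsMinimalAt a ∧
    ∃ (s₁ s₂ : ℕ) (hq : p + s₁ = q + s₂) (hr : m + s₁ = r + s₂),
      EquivalentAt (diagId G s₁)
        ((diagId L.transferFunction s₂).submatrix (Fin.cast hq) (Fin.cast hr)) a

end LinearSystemMatrix

end RatMat

end

open Polynomial

noncomputable section

namespace RatMat

variable {F : Type*} [Field F] {a : F}

/-! ### Matrices over the local ring at `a` -/

/-! Write `t` for the uniformizer λ - a. The invariant orders of G at a are encoded by the counts
N_G(k), the number of orders at most k, for all integers k. These counts can be certified without a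
normal form. A factorization U G V = t^k I_j with U, V defined at a certifies N_G(k) ≥ j
(`FactorsScalar`). A perturbation G - t^(k+1) E of rank at most j, with E defined at a, certifies
N_G(k) ≤ j (`LowRankMod`). The two certificates can only meet at the true count
(`FactorsScalar.le_of_lowRankMod`), and both are transported by multiplication with matrices defined
at a. Hence matrices of equal size are equivalent at a exactly when their counts agree.

Adjoining I_s adds s to N(k) for k ≥ 0 and nothing for k < 0. So a minimal system is a linearization
of G exactly when its transfer function Ĝ satisfies N_Ĝ(k) = N_G(k) + s for k ≥ 0 and N_Ĝ(k) =
N_G(k) for k < 0 (`isLinearizationAt_iff`).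

Minimality gives Bézout identities X A + Y C = 1 and A Z + B W = 1 with coefficients defined at a.
For negative orders, Ĝ = D + C A⁻¹ B, and Y Ĝ W differs from A⁻¹ by a matrix defined at a. So Ĝ and
A⁻¹ have the same poles, and these are the zeros of A (`countP_transferFunction`). For k ≥ 0 a block
elimination gives N_𝓛(k) = n + N_Ĝ(k) (`hasOrderCount_toMatrix`).

Condition (b) is then the counting criterion at k < 0. Condition (a) fixes the total number of
orders of 𝓛, and (c) fixes how many exceed each k ≥ 0. Together these two are the criterion at k ≥
0. -/

theorem def1_inv {x : RatFunc F} (hx : RatFunc.eval (RingHom.id F) a x ≠ 0) : Def1 a x⁻¹ := by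
  rw [def1_iff]
  -- A nonzero value forces the numerator, which serves as denominator of `x⁻¹`, not to vanish at
  -- `a`.
  refine ⟨x.denom, x.num, fun h => hx ?_, ?_⟩
  · simp [RatFunc.eval, h]
  · rw [← inv_div, RatFunc.num_div_denom]

theorem localEval_unif (h : Def1 a (unif a)) : localEval a ⟨unif a, h⟩ = 0 := by
  change RatFunc.eval (RingHom.id F) a (unif a) = 0
  rw [unif_eq, RatFunc.eval_algebraMap]
  simp

theorem def1_unif : Def1 a (unif a) := by
  simpa using def1_unif_zpow a (zero_le_one)

section Mat

variable {ι κ ι' κ' : Type*} [Fintype ι] [DecidableEq ι] [Fintype κ] [DecidableEq κ]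
  [Fintype ι'] [DecidableEq ι'] [Fintype κ'] [DecidableEq κ']

omit [Fintype ι] [DecidableEq ι] [Fintype κ] [DecidableEq κ] in
theorem DefinedAt.add {M N : Matrix ι κ (RatFunc F)} (hM : DefinedAt M a)
    (hN : DefinedAt N a) : DefinedAt (M + N) a :=
  fun i j => def1_add (hM i j) (hN i j)

omit [Fintype ι] [DecidableEq ι] [Fintype κ] [DecidableEq κ] in
theorem DefinedAt.neg {M : Matrix ι κ (RatFunc F)} (hM : DefinedAt M a) : DefinedAt (-M) a :=
  fun i j => def1_neg (hM i j)

omit [Fintype ι] [DecidableEq ι] [Fintype κ] [DecidableEq κ] in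
theorem DefinedAt.sub {M N : Matrix ι κ (RatFunc F)} (hM : DefinedAt M a)
    (hN : DefinedAt N a) : DefinedAt (M - N) a := by
  rw [sub_eq_add_neg]
  exact hM.add hN.neg

omit [Fintype ι] [DecidableEq ι] [Fintype κ] [DecidableEq κ] in
theorem DefinedAt.smul {x : RatFunc F} (hx : Def1 a x) {M : Matrix ι κ (RatFunc F)}
    (hM : DefinedAt M a) : DefinedAt (x • M) a :=
  fun i j => def1_mul hx (hM i j)

omit [Fintype ι] [DecidableEq ι] [Fintype κ] [DecidableEq κ] in
theorem definedAt_zero : DefinedAt (0 : Matrix ι κ (RatFunc F)) a := fun _ _ => def1_zero a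

omit [Fintype ι] [DecidableEq ι] [Fintype κ] [DecidableEq κ] in
theorem definedAt_toRat (P : Matrix ι κ F[X]) : DefinedAt (toRat P) a :=
  fun _ _ => def1_poly a _

omit [Fintype ι] [Fintype κ] [DecidableEq κ] in
theorem definedAt_diagonal {d : ι → RatFunc F} (hd : ∀ i, Def1 a (d i)) :
    DefinedAt (Matrix.diagonal d) a := by
  intro i j
  rw [Matrix.diagonal_apply]
  split_ifs
  · exact hd i
  · exact def1_zero a

omit [Fintype ι] [DecidableEq ι] [Fintype κ] [DecidableEq κ] [Fintype ι'] [DecidableEq ι']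
  [Fintype κ'] [DecidableEq κ'] in
theorem DefinedAt.fromBlocks {A : Matrix ι κ (RatFunc F)} {B : Matrix ι κ' (RatFunc F)}
    {C : Matrix ι' κ (RatFunc F)} {D : Matrix ι' κ' (RatFunc F)} (hA : DefinedAt A a)
    (hB : DefinedAt B a) (hC : DefinedAt C a) (hD : DefinedAt D a) :
    DefinedAt (Matrix.fromBlocks A B C D) a := by
  rintro (i | i) (j | j)
  exacts [hA i j, hB i j, hC i j, hD i j]

omit [DecidableEq ι] [Fintype κ] [DecidableEq κ] [Fintype ι'] [DecidableEq ι'] in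
theorem DefinedAt.mul {M : Matrix ι' ι (RatFunc F)} {N : Matrix ι κ (RatFunc F)}
    (hM : DefinedAt M a) (hN : DefinedAt N a) : DefinedAt (M * N) a := by
  intro i j
  rw [Matrix.mul_apply]
  exact def1_sum _ _ fun k _ => def1_mul (hM i k) (hN k j)

/-- A matrix defined at `a` lifts to `localRing a`, and the determinant commutes with both the
inclusion and the evaluation homomorphism. -/
theorem eval_det {R : Matrix ι ι (RatFunc F)} (hR : DefinedAt R a) :
    RatFunc.eval (RingHom.id F) a R.det = (evalAt R a).det := by
  let N : Matrix ι ι (localRing a) := Matrix.of fun i j => ⟨R i j, hR i j⟩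
  have h1 : (localRing a).subtype.mapMatrix N = R := rfl
  have h2 : (localEval a).mapMatrix N = evalAt R a := rfl
  rw [← h2, ← RingHom.map_det, ← h1, ← RingHom.map_det]
  rfl

theorem definedAt_adjugate {R : Matrix ι ι (RatFunc F)} (hR : DefinedAt R a) :
    DefinedAt R.adjugate a := by
  let N : Matrix ι ι (localRing a) := Matrix.of fun i j => ⟨R i j, hR i j⟩
  have h1 : (localRing a).subtype.mapMatrix N = R := rfl
  rw [← h1, ← RingHom.map_adjugate]
  exact fun i j => (N.adjugate i j).2

theorem RegularAt.isUnit_det {R : Matrix ι ι (RatFunc F)} (hR : RegularAt R a) :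
    IsUnit R.det :=
  isUnit_iff_ne_zero.mpr hR.det_ne_zero

/-- The inverse is det⁻¹ times the adjugate. The adjugate stays in the local ring, and det is a unit
there because its value at `a` is nonzero. -/
theorem RegularAt.definedAt_inv {R : Matrix ι ι (RatFunc F)} (hR : RegularAt R a) :
    DefinedAt R⁻¹ a := by
  rw [Matrix.inv_def, Ring.inverse_eq_inv]
  refine DefinedAt.smul (def1_inv ?_) (definedAt_adjugate hR.1)
  rw [eval_det hR.1]
  exact hR.2

theorem RegularAt.inv {R : Matrix ι ι (RatFunc F)} (hR : RegularAt R a) : RegularAt R⁻¹ a :=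
  regularAt_of_mul hR.definedAt_inv hR.1 (Matrix.nonsing_inv_mul _ hR.isUnit_det)

theorem EquivalentAt.symm {G H : Matrix ι κ (RatFunc F)} (h : EquivalentAt G H a) :
    EquivalentAt H G a := by
  obtain ⟨R, S, hR, hS, rfl⟩ := h
  refine ⟨R⁻¹, S⁻¹, hR.inv, hS.inv, ?_⟩
  rw [← Matrix.mul_assoc, Matrix.mul_nonsing_inv_cancel_right _ _ hS.isUnit_det,
    Matrix.nonsing_inv_mul_cancel_left _ _ hR.isUnit_det]

/-- A perturbation of the identity by a multiple of the uniformizer is regular. -/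
theorem regularAt_one_add_unif_smul {k : ℤ} (hk : 1 ≤ k) {W : Matrix ι ι (RatFunc F)}
    (hW : DefinedAt W a) : RegularAt (1 + unif a ^ k • W) a := by
  have hk' : Def1 a (unif a ^ (k - 1)) := def1_unif_zpow a (by omega)
  refine ⟨definedAt_one.add (hW.smul (def1_unif_zpow a (by omega))), ?_⟩
  have : evalAt (1 + unif a ^ k • W) a = 1 := by
    let N : Matrix ι ι (localRing a) := Matrix.of fun i j => ⟨W i j, hW i j⟩
    let t : localRing a := ⟨unif a, def1_unif⟩
    -- Since k ≥ 1, one factor `unif a` splits off with the rest still defined; that factor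
    -- evaluates to 0 and kills the perturbation.
    let t' : localRing a := ⟨unif a ^ (k - 1), hk'⟩
    have h : (localRing a).subtype.mapMatrix (1 + (t * t') • N) = 1 + unif a ^ k • W := by
      rw [map_add, map_one]
      congr 1
      ext i j
      have : unif a ^ k = unif a * unif a ^ (k - 1) := by
        rw [mul_comm, ← zpow_add_one₀ (unif_ne a), sub_add_cancel]
      simp [N, t, t', this]
    have h2 : evalAt ((localRing a).subtype.mapMatrix (1 + (t * t') • N)) a =
        (localEval a).mapMatrix (1 + (t * t') • N) := rfl
    rw [← h, h2, map_add, map_one]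
    have h3 : (localEval a).mapMatrix ((t * t') • N) = 0 := by
      ext i j
      simp [t, localEval_unif]
    rw [h3, add_zero]
  rw [this]
  simp

/-! ### Counting invariant orders without a normal form -/

/-- `(λ-a)^k I_j` factors through `G` with factors defined at `a`. -/
def FactorsScalar (G : Matrix ι κ (RatFunc F)) (a : F) (k : ℤ) (j : ℕ) : Prop :=
  ∃ (U : Matrix (Fin j) ι (RatFunc F)) (V : Matrix κ (Fin j) (RatFunc F)),
    DefinedAt U a ∧ DefinedAt V a ∧ U * G * V = unif a ^ k • 1

/-- Modulo `(λ-a)^{k+1}`, the matrix `G` has rank at most `t`. -/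
def LowRankMod (G : Matrix ι κ (RatFunc F)) (a : F) (k : ℤ) (t : ℕ) : Prop :=
  ∃ E : Matrix ι κ (RatFunc F), DefinedAt E a ∧ (G - unif a ^ (k + 1) • E).rank ≤ t

/-- Exactly `j` invariant orders of `G` at `a` are at most `k`. -/
def HasOrderCount (G : Matrix ι κ (RatFunc F)) (a : F) (k : ℤ) (j : ℕ) : Prop :=
  FactorsScalar G a k j ∧ LowRankMod G a k j

omit [DecidableEq ι] [DecidableEq κ] in
-- Allows the scalar block to be indexed by any finite type, such as a subtype or a sum.
theorem factorsScalar_card {G : Matrix ι κ (RatFunc F)} {k : ℤ} (U : Matrix ι' ι (RatFunc F))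
    (V : Matrix κ ι' (RatFunc F)) (hU : DefinedAt U a) (hV : DefinedAt V a)
    (h : U * G * V = unif a ^ k • 1) : FactorsScalar G a k (Fintype.card ι') := by
  let e := (Fintype.equivFin ι').symm
  refine ⟨U.submatrix e id, V.submatrix id e, fun i j => hU _ _, fun i j => hV _ _, ?_⟩
  have : U.submatrix e id * G * V.submatrix id e = (U * G * V).submatrix e e := rfl
  rw [this, h]
  ext i j
  simp [Matrix.one_apply]

omit [DecidableEq ι] [DecidableEq κ] in
-- Sandwiching the low-rank perturbation gives U (G - t^(k+1) E) V = t^k (1 - t U E V). The right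
-- side is an invertible j × j matrix, while the left side has rank at most that of the
-- perturbation.
theorem FactorsScalar.le_of_lowRankMod {G : Matrix ι κ (RatFunc F)} {k : ℤ} {j t : ℕ}
    (h : FactorsScalar G a k j) (h' : LowRankMod G a k t) : j ≤ t := by
  classical
  obtain ⟨U, V, hU, hV, hUV⟩ := h
  obtain ⟨E, hE, hr⟩ := h'
  have hW : DefinedAt (-(U * E * V)) a := ((hU.mul hE).mul hV).neg
  have hreg := regularAt_one_add_unif_smul le_rfl hW
  have heq : U * (G - unif a ^ (k + 1) • E) * V =
      unif a ^ k • (1 + unif a ^ (1 : ℤ) • -(U * E * V)) := by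
    rw [Matrix.mul_sub, Matrix.sub_mul, hUV, Matrix.mul_smul, Matrix.smul_mul, smul_add, smul_smul,
      ← zpow_add₀ (unif_ne a), smul_neg, sub_eq_add_neg]
  have hrank : (U * (G - unif a ^ (k + 1) • E) * V).rank = j := by
    rw [heq, Matrix.rank_of_det_ne_zero, Fintype.card_fin]
    rw [Matrix.det_smul]
    exact mul_ne_zero (pow_ne_zero _ (zpow_ne_zero _ (unif_ne a))) hreg.det_ne_zero
  rw [← hrank]
  exact (Matrix.rank_mul_le_left _ _).trans ((Matrix.rank_mul_le_right _ _).trans hr)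

omit [DecidableEq ι] [DecidableEq κ] in
theorem HasOrderCount.unique {G : Matrix ι κ (RatFunc F)} {k : ℤ} {j j' : ℕ}
    (h : HasOrderCount G a k j) (h' : HasOrderCount G a k j') : j = j' :=
  le_antisymm (h.1.le_of_lowRankMod h'.2) (h'.1.le_of_lowRankMod h.2)

/-- `G = P H Q` with `P` and `Q` defined at `a`. -/
def FactorsThrough (G : Matrix ι κ (RatFunc F)) (H : Matrix ι' κ' (RatFunc F)) (a : F) : Prop :=
  ∃ (P : Matrix ι ι' (RatFunc F)) (Q : Matrix κ' κ (RatFunc F)),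
    DefinedAt P a ∧ DefinedAt Q a ∧ G = P * H * Q

omit [DecidableEq ι] [DecidableEq κ] [DecidableEq ι'] [DecidableEq κ'] in
theorem FactorsThrough.factorsScalar {G : Matrix ι κ (RatFunc F)} {H : Matrix ι' κ' (RatFunc F)}
    (h : FactorsThrough G H a) {k : ℤ} {j : ℕ} (hG : FactorsScalar G a k j) :
    FactorsScalar H a k j := by
  classical
  obtain ⟨P, Q, hP, hQ, rfl⟩ := h
  obtain ⟨U, V, hU, hV, hUV⟩ := hG
  refine ⟨U * P, Q * V, hU.mul hP, hQ.mul hV, ?_⟩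
  rw [← hUV]
  simp only [Matrix.mul_assoc]

omit [Fintype ι] [DecidableEq ι] [DecidableEq κ] [DecidableEq ι'] [DecidableEq κ'] in
theorem FactorsThrough.lowRankMod {G : Matrix ι κ (RatFunc F)} {H : Matrix ι' κ' (RatFunc F)}
    (h : FactorsThrough G H a) {k : ℤ} {j : ℕ} (hH : LowRankMod H a k j) :
    LowRankMod G a k j := by
  classical
  obtain ⟨P, Q, hP, hQ, rfl⟩ := h
  obtain ⟨E, hE, hr⟩ := hH
  refine ⟨P * E * Q, (hP.mul hE).mul hQ, ?_⟩
  have : P * H * Q - unif a ^ (k + 1) • (P * E * Q) = P * (H - unif a ^ (k + 1) • E) * Q := by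
    simp [Matrix.mul_sub, Matrix.sub_mul]
  rw [this]
  exact (Matrix.rank_mul_le_left _ _).trans ((Matrix.rank_mul_le_right _ _).trans hr)

omit [DecidableEq ι] [DecidableEq κ] [DecidableEq ι'] [DecidableEq κ'] in
-- If G = P H Q, lower certificates pass from G to H and upper ones from H to G. Two-way factoring
-- therefore preserves counts, even between matrices of different sizes.
theorem HasOrderCount.of_factorsThrough {G : Matrix ι κ (RatFunc F)}
    {H : Matrix ι' κ' (RatFunc F)} {k : ℤ} {j : ℕ} (hG : HasOrderCount G a k j)
    (h : FactorsThrough G H a) (h' : FactorsThrough H G a) : HasOrderCount H a k j :=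
  ⟨h.factorsScalar hG.1, h'.lowRankMod hG.2⟩

theorem EquivalentAt.factorsThrough {G H : Matrix ι κ (RatFunc F)} (h : EquivalentAt G H a) :
    FactorsThrough H G a := by
  obtain ⟨R, S, hR, hS, rfl⟩ := h
  exact ⟨R, S, hR.1, hS.1, rfl⟩

theorem EquivalentAt.hasOrderCount {G H : Matrix ι κ (RatFunc F)} (h : EquivalentAt G H a)
    {k : ℤ} {j : ℕ} (hG : HasOrderCount G a k j) : HasOrderCount H a k j :=
  hG.of_factorsThrough h.symm.factorsThrough h.factorsThrough

omit [Fintype ι'] [DecidableEq ι'] [Fintype κ'] [DecidableEq κ'] in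
theorem factorsThrough_submatrix (G : Matrix ι κ (RatFunc F)) (e : ι' → ι) (f : κ' → κ) :
    FactorsThrough (G.submatrix e f) G a := by
  refine ⟨(1 : Matrix ι ι (RatFunc F)).submatrix e id,
    (1 : Matrix κ κ (RatFunc F)).submatrix id f, fun i j => definedAt_one _ _,
    fun i j => definedAt_one _ _, ?_⟩
  have : (1 : Matrix ι ι (RatFunc F)).submatrix e id * G *
      (1 : Matrix κ κ (RatFunc F)).submatrix id f = ((1 : Matrix ι ι (RatFunc F)) * G *
        (1 : Matrix κ κ (RatFunc F))).submatrix e f := rfl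
  rw [this, Matrix.one_mul, Matrix.mul_one]

theorem HasOrderCount.submatrix {G : Matrix ι κ (RatFunc F)} {k : ℤ} {j : ℕ}
    (h : HasOrderCount G a k j) (e : ι' ≃ ι) (f : κ' ≃ κ) :
    HasOrderCount (G.submatrix e f) a k j := by
  refine h.of_factorsThrough ?_ (factorsThrough_submatrix G e f)
  have := factorsThrough_submatrix (a := a) (G.submatrix e f) e.symm f.symm
  simpa using this

theorem hasOrderCount_diagonal (d : ι → ℤ) (k : ℤ) :
    HasOrderCount (Matrix.diagonal fun i => unif a ^ d i) a k
      (Fintype.card {i // d i ≤ k}) := by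
  classical
  constructor
  -- Lower certificate: select the coordinates with `d i ≤ k` and rescale each by t^(k - d i).
  · refine factorsScalar_card
      ((1 : Matrix ι ι (RatFunc F)).submatrix (Subtype.val : {i // d i ≤ k} → ι) id)
      ((Matrix.diagonal fun i => if d i ≤ k then unif a ^ (k - d i) else 0).submatrix id
        (Subtype.val : {i // d i ≤ k} → ι)) (fun i j => definedAt_one _ _) ?_ ?_
    · have : DefinedAt (Matrix.diagonal fun i => if d i ≤ k then unif a ^ (k - d i) else 0) a := by
        refine definedAt_diagonal fun i => ?_
        split_ifs with h
        · exact def1_unif_zpow a (by omega)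
        · exact def1_zero a
      exact fun i j => this _ _
    · have : ∀ D E : Matrix ι ι (RatFunc F),
          (1 : Matrix ι ι (RatFunc F)).submatrix (Subtype.val : {i // d i ≤ k} → ι) id * D *
          E.submatrix id (Subtype.val : {i // d i ≤ k} → ι) =
          (1 * D * E).submatrix Subtype.val Subtype.val := fun _ _ => rfl
      rw [this, Matrix.one_mul, Matrix.diagonal_mul_diagonal]
      ext i j
      by_cases hij : i = j
      · subst hij
        simp [i.2, ← zpow_add₀ (unif_ne a)]
      · have : i.1 ≠ j.1 := fun h => hij (Subtype.ext h)
        simp [hij, this]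
  -- Upper certificate: entries with `d i ≥ k + 1` are multiples of t^(k+1) and can be subtracted,
  -- leaving only the other diagonal entries.
  · refine ⟨Matrix.diagonal fun i => if d i ≤ k then 0 else unif a ^ (d i - (k + 1)),
      definedAt_diagonal fun i => ?_, ?_⟩
    · split_ifs with h
      · exact def1_zero a
      · exact def1_unif_zpow a (by omega)
    · rw [← Matrix.diagonal_smul, Matrix.diagonal_sub, Matrix.rank_diagonal]
      refine Fintype.card_le_of_injective
        (fun i => (⟨i.1, ?_⟩ : {i // d i ≤ k})) fun i j hij => Subtype.ext ?_
      · by_contra hcon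
        apply i.2
        simp [hcon, ← zpow_add₀ (unif_ne a)]
      · simpa using hij

omit [DecidableEq ι] [DecidableEq κ] in
/-- A `FactorsScalar` relation of negative order may be tested up to terms defined at `a`. -/
theorem factorsScalar_of_add {G : Matrix ι κ (RatFunc F)} {k : ℤ} (hk : 1 ≤ k) {j : ℕ}
    {U : Matrix (Fin j) ι (RatFunc F)} {V : Matrix κ (Fin j) (RatFunc F)}
    {W : Matrix (Fin j) (Fin j) (RatFunc F)} (hU : DefinedAt U a) (hV : DefinedAt V a)
    (hW : DefinedAt W a) (h : U * G * V = unif a ^ (-k) • 1 + W) :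
    FactorsScalar G a (-k) j := by
  have hreg := regularAt_one_add_unif_smul hk hW
  refine ⟨U, V * (1 + unif a ^ k • W)⁻¹, hU, hV.mul hreg.definedAt_inv, ?_⟩
  have : unif a ^ (-k) • 1 + W = unif a ^ (-k) • (1 + unif a ^ k • W) := by
    rw [smul_add, smul_smul, ← zpow_add₀ (unif_ne a)]
    simp
  rw [← Matrix.mul_assoc, h, this, Matrix.smul_mul, Matrix.mul_nonsing_inv _ hreg.isUnit_det]

end Mat

theorem rank_matrix_add_le {ι κ : Type*} [Fintype ι] [Fintype κ]
    (M N : Matrix ι κ (RatFunc F)) : (M + N).rank ≤ M.rank + N.rank := by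
  have h : LinearMap.range (M + N).mulVecLin ≤
      LinearMap.range M.mulVecLin ⊔ LinearMap.range N.mulVecLin := by
    rw [Matrix.mulVecLin_add]
    exact LinearMap.range_add_le _ _
  exact (Submodule.finrank_mono h).trans (Submodule.finrank_add_le_finrank_add_finrank _ _)

/-! ### Order counts of normal forms -/

theorem card_get_eq_countP (ν : List ℤ) (P : ℤ → Prop) [DecidablePred P] :
    Fintype.card {i : Fin ν.length // P ν[i]} = ν.countP P := by
  induction ν with
  | nil => simp
  | cons x l ih =>
    rw [Fintype.card_subtype] at ih ⊢
    simp only [List.length_cons]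
    rw [Fin.card_filter_univ_succ', List.countP_cons, ← ih, add_comm]
    simp only [List.getElem_cons_succ, Fin.getElem_fin, Fin.val_succ, Fin.val_zero,
      List.getElem_cons_zero, decide_eq_true_eq]
    congr 1

theorem smithMcMillanForm_submatrix (p m : ℕ) (ν : List ℤ) (hp : ν.length ≤ p)
    (hm : ν.length ≤ m) :
    (smithMcMillanForm p m a ν).submatrix (Fin.castLE hp) (Fin.castLE hm) =
      Matrix.diagonal fun i : Fin ν.length => unif a ^ ν[i] := by
  ext i j
  by_cases hij : i = j
  · subst hij
    simp [smithMcMillanForm, unif]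
  · have : i.val ≠ j.val := fun h => hij (Fin.ext h)
    simp [smithMcMillanForm, hij, this]

/-- The local Smith–McMillan form factors through its nonzero diagonal part. -/
theorem smithMcMillanForm_factorsThrough (p m : ℕ) (ν : List ℤ) (hp : ν.length ≤ p)
    (hm : ν.length ≤ m) :
    FactorsThrough (smithMcMillanForm p m a ν)
      (Matrix.diagonal fun i : Fin ν.length => unif a ^ ν[i]) a := by
  refine ⟨(1 : Matrix (Fin p) (Fin p) (RatFunc F)).submatrix id (Fin.castLE hp),
    (1 : Matrix (Fin m) (Fin m) (RatFunc F)).submatrix (Fin.castLE hm) id,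
    fun i j => definedAt_one _ _, fun i j => definedAt_one _ _, ?_⟩
  ext i j
  rw [Matrix.mul_apply]
  simp only [Matrix.mul_diagonal, Matrix.submatrix_apply, id, Matrix.one_apply]
  by_cases h : i.val = j.val ∧ i.val < ν.length
  · rw [Finset.sum_eq_single ⟨i.val, h.2⟩]
    · have h1 : i = Fin.castLE hp ⟨i.val, h.2⟩ := rfl
      have h2 : Fin.castLE hm ⟨i.val, h.2⟩ = j := Fin.ext h.1
      rw [if_pos h1, if_pos h2]
      rw [smithMcMillanForm, Matrix.of_apply, dif_pos h, one_mul, mul_one]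
      rfl
    · intro x _ hx
      rw [if_neg]
      · simp
      · exact fun h' => hx (Fin.ext (congrArg Fin.val h').symm)
    · simp
  · rw [Finset.sum_eq_zero]
    · simp [smithMcMillanForm, h]
    · intro x _
      by_cases h1 : i = Fin.castLE hp x
      · rw [if_neg (c := Fin.castLE hm x = j), mul_zero]
        intro h2
        apply h
        rw [h1, ← h2]
        exact ⟨rfl, x.2⟩
      · simp [h1]

namespace IsInvariantOrders

variable {p m : ℕ} {G : Matrix (Fin p) (Fin m) (RatFunc F)} {ν : List ℤ}

/-- Discards the zero padding, so that counts can be computed on a square diagonal matrix. -/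
theorem factorsThrough_diagonal (h : IsInvariantOrders G a ν) :
    FactorsThrough G (Matrix.diagonal fun i : Fin ν.length => unif a ^ ν[i]) a ∧
      FactorsThrough (Matrix.diagonal fun i : Fin ν.length => unif a ^ ν[i]) G a := by
  obtain ⟨-, h2, h3⟩ := h
  have hp : ν.length ≤ p := h2 ▸ (by simpa using G.rank_le_card_height)
  have hm : ν.length ≤ m := h2 ▸ (by simpa using G.rank_le_card_width)
  constructor
  · obtain ⟨P, Q, hP, hQ, h⟩ := h3.symm.factorsThrough
    obtain ⟨P', Q', hP', hQ', h'⟩ := smithMcMillanForm_factorsThrough (a := a) p m ν hp hm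
    exact ⟨P * P', Q' * Q, hP.mul hP', hQ'.mul hQ, by
      rw [h, h']; simp only [Matrix.mul_assoc]⟩
  · rw [← smithMcMillanForm_submatrix p m ν hp hm]
    obtain ⟨P, Q, hP, hQ, h⟩ := h3.factorsThrough
    obtain ⟨P', Q', hP', hQ', h'⟩ :=
      factorsThrough_submatrix (a := a) (smithMcMillanForm p m a ν) (Fin.castLE hp)
        (Fin.castLE hm)
    exact ⟨P' * P, Q * Q', hP'.mul hP, hQ.mul hQ', by
      rw [h', h]; simp only [Matrix.mul_assoc]⟩

theorem hasOrderCount (h : IsInvariantOrders G a ν) (k : ℤ) :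
    HasOrderCount G a k (ν.countP (· ≤ k)) := by
  have h1 := hasOrderCount_diagonal (a := a) (fun i : Fin ν.length => ν[i]) k
  rw [card_get_eq_countP ν (· ≤ k)] at h1
  exact h1.of_factorsThrough h.factorsThrough_diagonal.2 h.factorsThrough_diagonal.1

end IsInvariantOrders

/-! ### Integer lists recovered from their counts -/

theorem exists_forall_le_countP_eq_length (ν : List ℤ) :
    ∃ k₀ : ℤ, ∀ k, k₀ ≤ k → ν.countP (· ≤ k) = ν.length := by
  induction ν with
  | nil => exact ⟨0, by simp⟩
  | cons x l ih =>
    obtain ⟨k₀, h⟩ := ih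
    refine ⟨max k₀ x, fun k hk => ?_⟩
    rw [List.countP_cons_of_pos (by simpa using (le_max_right _ _).trans hk),
      h k ((le_max_left _ _).trans hk), List.length_cons]

theorem countP_le_pred_add_count (ν : List ℤ) (k : ℤ) :
    ν.countP (· ≤ k - 1) + ν.count k = ν.countP (· ≤ k) := by
  induction ν with
  | nil => simp
  | cons x l ih =>
    simp only [List.countP_cons, List.count_cons, decide_eq_true_eq, beq_iff_eq]
    split_ifs <;> omega

/-- The multiplicity of k is the difference of the counts at k and k - 1, and sorted lists with
equal multiplicities coincide. -/
theorem eq_of_countP_le_eq {ν μ : List ℤ} (hν : ν.Pairwise (· ≤ ·)) (hμ : μ.Pairwise (· ≤ ·))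
    (h : ∀ k, ν.countP (· ≤ k) = μ.countP (· ≤ k)) : ν = μ := by
  have hp : ν.Perm μ := by
    rw [List.perm_iff_count]
    intro k
    have h1 := countP_le_pred_add_count ν k
    have h2 := countP_le_pred_add_count μ k
    rw [h, h] at h1
    omega
  exact hp.eq_of_pairwise' hν hμ

/-- Matrices of the same size with the same order counts are equivalent at `a`. -/
theorem equivalentAt_of_hasOrderCount {p m : ℕ} {G H : Matrix (Fin p) (Fin m) (RatFunc F)}
    (h : ∀ k, ∃ j, HasOrderCount G a k j ∧ HasOrderCount H a k j) : EquivalentAt G H a := by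
  obtain ⟨ν, hν⟩ := exists_isInvariantOrders G a
  obtain ⟨μ, hμ⟩ := exists_isInvariantOrders H a
  have : ν = μ := by
    refine eq_of_countP_le_eq hν.1 hμ.1 fun k => ?_
    obtain ⟨j, h1, h2⟩ := h k
    rw [← h1.unique (hν.hasOrderCount k), ← h2.unique (hμ.hasOrderCount k)]
  subst this
  exact hν.2.2.trans hμ.2.2.symm

/-! ### Effect of an adjoined identity block on the counts -/

theorem FactorsScalar.diagId {p m : ℕ} {G : Matrix (Fin p) (Fin m) (RatFunc F)} {k : ℤ} {j : ℕ}
    (h : FactorsScalar G a k j) (s : ℕ) :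
    FactorsScalar (diagId G s) a k (j + if 0 ≤ k then s else 0) := by
  obtain ⟨U, V, hU, hV, hUV⟩ := h
  suffices h : FactorsScalar (Matrix.fromBlocks G 0 0 (1 : Matrix (Fin s) (Fin s) (RatFunc F)))
      a k (j + if 0 ≤ k then s else 0) by
    refine FactorsThrough.factorsScalar ?_ h
    have := factorsThrough_submatrix (a := a) (RatMat.diagId G s) finSumFinEquiv finSumFinEquiv
    simpa [RatMat.diagId] using this
  split_ifs with hk
  · have := factorsScalar_card (a := a) (k := k)
      (G := Matrix.fromBlocks G 0 0 (1 : Matrix (Fin s) (Fin s) (RatFunc F)))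
      (Matrix.fromBlocks U 0 0 1) (Matrix.fromBlocks V 0 0 (unif a ^ k • 1))
      (hU.fromBlocks definedAt_zero definedAt_zero definedAt_one)
      (hV.fromBlocks definedAt_zero definedAt_zero (definedAt_one.smul (def1_unif_zpow a hk)))
      (by
        rw [Matrix.fromBlocks_multiply, Matrix.fromBlocks_multiply, ← Matrix.fromBlocks_one,
          Matrix.fromBlocks_smul]
        simp [hUV])
    simpa using this
  · rw [add_zero]
    refine ⟨Matrix.fromCols U 0, Matrix.fromRows V 0, ?_, ?_, ?_⟩
    · rintro i (l | l)
      exacts [hU i l, def1_zero a]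
    · rintro (l | l) i
      exacts [hV l i, def1_zero a]
    · rw [Matrix.fromCols_mul_fromBlocks, Matrix.fromCols_mul_fromRows]
      simp [hUV]

theorem LowRankMod.diagId {p m : ℕ} {G : Matrix (Fin p) (Fin m) (RatFunc F)} {k : ℤ} {t : ℕ}
    (h : LowRankMod G a k t) (s : ℕ) :
    LowRankMod (diagId G s) a k (t + if 0 ≤ k then s else 0) := by
  obtain ⟨E, hE, hr⟩ := h
  suffices h : LowRankMod (Matrix.fromBlocks G 0 0 (1 : Matrix (Fin s) (Fin s) (RatFunc F)))
      a k (t + if 0 ≤ k then s else 0) from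
    (factorsThrough_submatrix _ _ _).lowRankMod h
  have key : ∀ (M : Matrix (Fin p) (Fin m) (RatFunc F)),
      Matrix.fromBlocks M 0 0 (0 : Matrix (Fin s) (Fin s) (RatFunc F)) =
      (Matrix.fromRows 1 0 : Matrix (Fin p ⊕ Fin s) (Fin p) (RatFunc F)) * M *
        (Matrix.fromCols 1 0 : Matrix (Fin m) (Fin m ⊕ Fin s) (RatFunc F)) := by
    intro M
    rw [Matrix.fromRows_mul, Matrix.fromRows_mul_fromCols]
    simp
  have key2 : (Matrix.fromBlocks 0 0 0 (1 : Matrix (Fin s) (Fin s) (RatFunc F)) :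
      Matrix (Fin p ⊕ Fin s) (Fin m ⊕ Fin s) (RatFunc F)) =
      (Matrix.fromRows 0 1 : Matrix (Fin p ⊕ Fin s) (Fin s) (RatFunc F)) *
        (Matrix.fromCols 0 1 : Matrix (Fin s) (Fin m ⊕ Fin s) (RatFunc F)) := by
    rw [Matrix.fromRows_mul_fromCols]
    simp
  have hr' : (Matrix.fromBlocks (G - unif a ^ (k + 1) • E) 0 0
      (0 : Matrix (Fin s) (Fin s) (RatFunc F))).rank ≤ t := by
    rw [key]
    exact (Matrix.rank_mul_le_left _ _).trans ((Matrix.rank_mul_le_right _ _).trans hr)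
  split_ifs with hk
  · refine ⟨Matrix.fromBlocks E 0 0 0,
      hE.fromBlocks definedAt_zero definedAt_zero definedAt_zero, ?_⟩
    have : Matrix.fromBlocks G 0 0 (1 : Matrix (Fin s) (Fin s) (RatFunc F)) -
        unif a ^ (k + 1) • Matrix.fromBlocks E 0 0 0 =
        Matrix.fromBlocks (G - unif a ^ (k + 1) • E) 0 0 0 + Matrix.fromBlocks 0 0 0 1 := by
      rw [Matrix.fromBlocks_smul, sub_eq_add_neg, Matrix.fromBlocks_neg, Matrix.fromBlocks_add,
        Matrix.fromBlocks_add]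
      simp [sub_eq_add_neg]
    rw [this]
    refine (rank_matrix_add_le _ _).trans (add_le_add hr' ?_)
    rw [key2]
    exact (Matrix.rank_mul_le_left _ _).trans ((Matrix.rank_le_card_width _).trans (by simp))
  -- For k < 0 the identity block is itself t^(k+1) times a matrix defined at `a`, so it is absorbed
  -- into the error term.
  · refine ⟨Matrix.fromBlocks E 0 0 (unif a ^ (-(k + 1)) • 1),
      hE.fromBlocks definedAt_zero definedAt_zero
        (definedAt_one.smul (def1_unif_zpow a (by omega))), ?_⟩
    have : Matrix.fromBlocks G 0 0 (1 : Matrix (Fin s) (Fin s) (RatFunc F)) -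
        unif a ^ (k + 1) • Matrix.fromBlocks E 0 0 (unif a ^ (-(k + 1)) • 1) =
        Matrix.fromBlocks (G - unif a ^ (k + 1) • E) 0 0 0 := by
      rw [Matrix.fromBlocks_smul, smul_smul, ← zpow_add₀ (unif_ne a), sub_eq_add_neg,
        Matrix.fromBlocks_neg, Matrix.fromBlocks_add]
      simp [sub_eq_add_neg]
    rw [this, add_zero]
    exact hr'

theorem HasOrderCount.diagId {p m : ℕ} {G : Matrix (Fin p) (Fin m) (RatFunc F)} {k : ℤ} {j : ℕ}
    (h : HasOrderCount G a k j) (s : ℕ) :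
    HasOrderCount (diagId G s) a k (j + if 0 ≤ k then s else 0) :=
  ⟨h.1.diagId s, h.2.diagId s⟩

/-! ### Order counts of the transfer function of a minimal system -/

/-- For `k ≥ 0` the factorization of `(λ-a)^k I` through `G` can be chosen with `G V` defined. -/
theorem IsInvariantOrders.exists_definedAt_mul {p m : ℕ} {G : Matrix (Fin p) (Fin m) (RatFunc F)}
    {ν : List ℤ} (h : IsInvariantOrders G a ν) {k : ℤ} (hk : 0 ≤ k) :
    ∃ (U : Matrix {i : Fin ν.length // ν[i] ≤ k} (Fin p) (RatFunc F))
      (V : Matrix (Fin m) {i : Fin ν.length // ν[i] ≤ k} (RatFunc F)),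
      DefinedAt U a ∧ DefinedAt V a ∧ DefinedAt (G * V) a ∧ U * G * V = unif a ^ k • 1 := by
  obtain ⟨-, h2, R, S, hR, hS, hRS⟩ := h
  have hp : ν.length ≤ p := h2 ▸ (by simpa using G.rank_le_card_height)
  have hm : ν.length ≤ m := h2 ▸ (by simpa using G.rank_le_card_width)
  -- Scaling the selected basis vectors by t^(k - ν_i) makes every entry of the Smith–McMillan form
  -- times V equal to 0 or t^k. This is defined at `a` because k ≥ 0.
  let V : Matrix (Fin m) {i : Fin ν.length // ν[i] ≤ k} (RatFunc F) :=
    Matrix.of fun l t => if l = Fin.castLE hm t.1 then unif a ^ (k - ν[t.1]) else 0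
  have hV : DefinedAt V a := by
    intro l t
    change Def1 a (if l = Fin.castLE hm t.1 then unif a ^ (k - ν[t.1]) else 0)
    split_ifs
    · exact def1_unif_zpow a (by have := t.2; omega)
    · exact def1_zero a
  have hmul : ∀ i t, (smithMcMillanForm p m a ν * V) i t =
      if i.val = t.1.val then unif a ^ k else 0 := by
    intro i t
    rw [Matrix.mul_apply, Finset.sum_eq_single (Fin.castLE hm t.1)]
    · by_cases hit : i.val = t.1.val
      · simp [V, smithMcMillanForm, hit, ← unif.eq_def, ← zpow_add₀ (unif_ne a)]
      · simp [smithMcMillanForm, hit]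
    · intro l _ hl
      simp [V, hl]
    · simp
  let U : Matrix {i : Fin ν.length // ν[i] ≤ k} (Fin p) (RatFunc F) :=
    (1 : Matrix (Fin p) (Fin p) (RatFunc F)).submatrix (fun t => Fin.castLE hp t.1) id
  have hU : DefinedAt U a := fun i j => definedAt_one _ _
  refine ⟨U * R, S * V, hU.mul hR.1, hS.1.mul hV, ?_, ?_⟩
  · have : G * (S * V) = R⁻¹ * (smithMcMillanForm p m a ν * V) := by
      rw [← hRS]
      simp only [Matrix.mul_assoc]
      rw [Matrix.nonsing_inv_mul_cancel_left _ _ hR.isUnit_det]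
    rw [this]
    refine hR.definedAt_inv.mul fun i t => ?_
    change Def1 a _
    rw [hmul]
    split_ifs
    · exact def1_unif_zpow a hk
    · exact def1_zero a
  · have : U * R * G * (S * V) = U * (smithMcMillanForm p m a ν * V) := by
      rw [← hRS]
      simp only [Matrix.mul_assoc]
    rw [this]
    have h1 : U * (smithMcMillanForm p m a ν * V) =
        ((1 : Matrix (Fin p) (Fin p) (RatFunc F)) * (smithMcMillanForm p m a ν * V)).submatrix
          (fun t => Fin.castLE hp t.1) id := rfl
    rw [h1, Matrix.one_mul]
    ext i j
    rw [Matrix.submatrix_apply, hmul]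
    by_cases hij : i = j
    · simp [hij]
    · have : i.1.val ≠ j.1.val := fun h => hij (Subtype.ext (Fin.ext h))
      simp [hij, this]

theorem hasOrderCount_of_definedAt {ι κ : Type*} [Fintype ι] [Fintype κ]
    {M : Matrix ι κ (RatFunc F)} (hM : DefinedAt M a) {k : ℤ} (hk : k < 0) :
    HasOrderCount M a k 0 := by
  refine ⟨⟨0, 0, definedAt_zero, definedAt_zero, Subsingleton.elim _ _⟩,
    unif a ^ (-(k + 1)) • M, hM.smul (def1_unif_zpow a (by omega)), ?_⟩
  rw [smul_smul, ← zpow_add₀ (unif_ne a)]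
  simp

/-- Inverting the local Smith–McMillan form negates the orders, and -μ_i ≤ -k means k ≤ μ_i. -/
theorem IsInvariantOrders.hasOrderCount_inv {n : ℕ} {A : Matrix (Fin n) (Fin n) (RatFunc F)}
    {μ : List ℤ} (h : IsInvariantOrders A a μ) (hA : IsUnit A.det) (k : ℤ) :
    HasOrderCount A⁻¹ a (-k) (μ.countP (k ≤ ·)) := by
  obtain ⟨-, h2, R, S, hR, hS, hRS⟩ := h
  -- A nonsingular matrix has full rank, so its form is a square diagonal matrix without zero
  -- padding.
  have hlen : μ.length = n := by
    rw [h2, Matrix.rank_of_det_ne_zero hA.ne_zero, Fintype.card_fin]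
  subst hlen
  have hdiag := smithMcMillanForm_submatrix (a := a) μ.length μ.length μ le_rfl le_rfl
  rw [show (Fin.castLE (le_refl μ.length)) = id from rfl, Matrix.submatrix_id_id] at hdiag
  rw [hdiag] at hRS
  have hinv : S⁻¹ * A⁻¹ * R⁻¹ = Matrix.diagonal fun i : Fin μ.length => unif a ^ (-μ[i]) := by
    rw [← Matrix.mul_inv_rev, ← Matrix.mul_inv_rev, ← Matrix.mul_assoc, hRS]
    refine Matrix.inv_eq_right_inv ?_
    rw [Matrix.diagonal_mul_diagonal, ← Matrix.diagonal_one]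
    congr 1
    funext i
    rw [← zpow_add₀ (unif_ne a)]
    simp
  have hc := hasOrderCount_diagonal (a := a) (fun i : Fin μ.length => -μ[i]) (-k)
  have heq : EquivalentAt A⁻¹ (Matrix.diagonal fun i : Fin μ.length => unif a ^ (-μ[i])) a :=
    ⟨S⁻¹, R⁻¹, hS.inv, hR.inv, hinv⟩
  have := heq.symm.hasOrderCount hc
  rwa [card_get_eq_countP μ (fun x => -x ≤ -k), show (fun x : ℤ => decide (-x ≤ -k)) =
    (fun x : ℤ => decide (k ≤ x)) by simp] at this

/-! ### A system matrix compared with its transfer function -/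

section System

variable {n q r : ℕ} {A : Matrix (Fin n) (Fin n) (RatFunc F)}
  {B : Matrix (Fin n) (Fin r) (RatFunc F)} {C : Matrix (Fin q) (Fin n) (RatFunc F)}
  {D : Matrix (Fin q) (Fin r) (RatFunc F)} {X Z : Matrix (Fin n) (Fin n) (RatFunc F)}
  {Y : Matrix (Fin n) (Fin q) (RatFunc F)} {W : Matrix (Fin r) (Fin n) (RatFunc F)}

/-- Multiplying the system matrix by [Z, -A⁻¹BV; W, V] yields [1, 0; -CZ + DW, ĜV]. A lower
triangular left factor then clears the corner and turns ĜV into UĜV = t^k I. The remaining identity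
block is rescaled by t^k. -/
theorem factorsScalar_fromBlocks (hA : IsUnit A.det) (hB : DefinedAt B a) (hC : DefinedAt C a)
    (hD : DefinedAt D a) (hX : DefinedAt X a) (hY : DefinedAt Y a) (hZ : DefinedAt Z a)
    (hW : DefinedAt W a) (hXY : X * A + Y * C = 1) (hZW : A * Z + B * W = 1) {k : ℤ}
    (hk : 0 ≤ k) {ν : List ℤ} (hν : IsInvariantOrders (D + C * A⁻¹ * B) a ν) :
    FactorsScalar (Matrix.fromBlocks A B (-C) D) a k (n + ν.countP (· ≤ k)) := by
  obtain ⟨U, V, hU, hV, hGV, hUV⟩ := hν.exists_definedAt_mul hk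
  have hAx : A * -(A⁻¹ * B * V) = -(B * V) := by
    rw [Matrix.mul_neg, Matrix.mul_assoc, Matrix.mul_nonsing_inv_cancel_left _ _ hA]
  have hCx : -C * -(A⁻¹ * B * V) + D * V = (D + C * A⁻¹ * B) * V := by
    rw [Matrix.add_mul, Matrix.neg_mul, Matrix.mul_neg, neg_neg, add_comm]
    simp only [Matrix.mul_assoc]
  -- For x = -A⁻¹BV both Ax = -BV and Cx = DV - ĜV are defined at `a`, the latter because V was
  -- chosen with ĜV defined. Then x = X(Ax) + Y(Cx).
  have hx : DefinedAt (-(A⁻¹ * B * V)) a := by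
    have h1 : -(A⁻¹ * B * V) = X * (A * -(A⁻¹ * B * V)) + Y * (C * -(A⁻¹ * B * V)) := by
      rw [← Matrix.mul_assoc X, ← Matrix.mul_assoc Y, ← Matrix.add_mul, hXY, Matrix.one_mul]
    have h2 : C * -(A⁻¹ * B * V) = D * V - (D + C * A⁻¹ * B) * V := by
      rw [← hCx, Matrix.neg_mul]
      abel
    rw [h1, hAx, h2]
    exact (hX.mul (hB.mul hV).neg).add (hY.mul ((hD.mul hV).sub hGV))
  have := factorsScalar_card (a := a) (k := k) (G := Matrix.fromBlocks A B (-C) D)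
    (Matrix.fromBlocks 1 0 (-(U * (-C * Z + D * W))) U)
    (Matrix.fromBlocks Z (-(A⁻¹ * B * V)) W V * Matrix.fromBlocks (unif a ^ k • 1) 0 0 1)
    (definedAt_one.fromBlocks definedAt_zero
      (hU.mul ((hC.neg.mul hZ).add (hD.mul hW))).neg hU)
    ((hZ.fromBlocks hx hW hV).mul ((definedAt_one.smul (def1_unif_zpow a hk)).fromBlocks
      definedAt_zero definedAt_zero definedAt_one))
    (by
      rw [Matrix.mul_assoc, ← Matrix.mul_assoc (Matrix.fromBlocks A B (-C) D),
        Matrix.fromBlocks_multiply A, hZW, hAx, hCx, neg_add_cancel, ← Matrix.mul_assoc,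
        Matrix.fromBlocks_multiply, Matrix.fromBlocks_multiply, ← Matrix.mul_assoc U, hUV,
        ← Matrix.fromBlocks_one, Matrix.fromBlocks_smul]
      simp)
  rwa [Fintype.card_sum, Fintype.card_fin, card_get_eq_countP ν (· ≤ k)] at this

/-- Up to a low-rank perturbation of Ĝ in the lower right corner, the system matrix is [1; -CA⁻¹][A,
B], of rank at most n. The factor CA⁻¹ may have a pole at `a`, since only its rank contribution
matters. -/
theorem lowRankMod_fromBlocks (hA : IsUnit A.det) {k : ℤ} {t : ℕ}
    (h : LowRankMod (D + C * A⁻¹ * B) a k t) :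
    LowRankMod (Matrix.fromBlocks A B (-C) D) a k (n + t) := by
  obtain ⟨E, hE, hr⟩ := h
  refine ⟨Matrix.fromBlocks 0 0 0 E, definedAt_zero.fromBlocks definedAt_zero definedAt_zero hE,
    ?_⟩
  have : Matrix.fromBlocks A B (-C) D - unif a ^ (k + 1) • Matrix.fromBlocks 0 0 0 E =
      (Matrix.fromRows 1 (-(C * A⁻¹)) : Matrix (Fin n ⊕ Fin q) (Fin n) (RatFunc F)) *
        (Matrix.fromCols A B) +
      (Matrix.fromRows 0 1 : Matrix (Fin n ⊕ Fin q) (Fin q) (RatFunc F)) *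
        (D + C * A⁻¹ * B - unif a ^ (k + 1) • E) *
        (Matrix.fromCols 0 1 : Matrix (Fin r) (Fin n ⊕ Fin r) (RatFunc F)) := by
    rw [Matrix.fromRows_mul_fromCols, Matrix.fromRows_mul, Matrix.fromRows_mul_fromCols,
      Matrix.fromBlocks_add, Matrix.fromBlocks_smul, sub_eq_add_neg, Matrix.fromBlocks_neg,
      Matrix.fromBlocks_add]
    simp only [Matrix.neg_mul, Matrix.nonsing_inv_mul_cancel_right _ _ hA]
    congr 1
    · simp
    · simp
    · simp
    · simp only [Matrix.one_mul, Matrix.mul_one]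
      abel
  rw [this]
  refine (rank_matrix_add_le _ _).trans (add_le_add ?_ ?_)
  · exact (Matrix.rank_mul_le_left _ _).trans ((Matrix.rank_le_card_width _).trans (by simp))
  · exact (Matrix.rank_mul_le_left _ _).trans ((Matrix.rank_mul_le_right _ _).trans hr)

/-- Modulo matrices defined at `a`, Ĝ is C A⁻¹ B and Y Ĝ W is A⁻¹. Such terms do not affect negative
orders, by `factorsScalar_of_add`. -/
theorem factorsScalar_transfer_iff (hA : IsUnit A.det) (hA' : DefinedAt A a)
    (hB : DefinedAt B a) (hC : DefinedAt C a)
    (hD : DefinedAt D a) (hX : DefinedAt X a) (hY : DefinedAt Y a) (hZ : DefinedAt Z a)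
    (hW : DefinedAt W a) (hXY : X * A + Y * C = 1) (hZW : A * Z + B * W = 1) {k : ℤ}
    (hk : 1 ≤ k) (j : ℕ) :
    FactorsScalar (D + C * A⁻¹ * B) a (-k) j ↔ FactorsScalar A⁻¹ a (-k) j := by
  constructor
  · rintro ⟨U, V, hU, hV, hUV⟩
    refine factorsScalar_of_add hk (hU.mul hC) (hB.mul hV) ((hU.mul hD).mul hV).neg ?_
    rw [← hUV, Matrix.mul_add, Matrix.add_mul]
    simp only [Matrix.mul_assoc]
    abel
  · rintro ⟨U, V, hU, hV, hUV⟩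
    refine factorsScalar_of_add (W := U * (Y * D * W - Z - X + X * A * Z) * V) hk (hU.mul hY)
      (hW.mul hV)
      ((hU.mul (((((hY.mul hD).mul hW).sub hZ).sub hX).add ((hX.mul hA').mul hZ))).mul hV) ?_
    have hYC : Y * C = 1 - X * A := by rw [← hXY]; abel
    have hBW : B * W = 1 - A * Z := by rw [← hZW]; abel
    -- The Bézout identities give YC A⁻¹ BW = (1 - XA) A⁻¹ (1 - AZ) = A⁻¹ - Z - X + XAZ.
    have key : Y * (D + C * A⁻¹ * B) * W = A⁻¹ + (Y * D * W - Z - X + X * A * Z) := by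
      have : Y * (D + C * A⁻¹ * B) * W = Y * D * W + Y * C * A⁻¹ * (B * W) := by
        rw [Matrix.mul_add, Matrix.add_mul]
        simp only [Matrix.mul_assoc]
      rw [this, hYC, hBW, Matrix.sub_mul, Matrix.mul_nonsing_inv_cancel_right _ _ hA,
        Matrix.one_mul, Matrix.mul_sub, Matrix.mul_one, Matrix.sub_mul A⁻¹,
        Matrix.nonsing_inv_mul_cancel_left _ _ hA, ← Matrix.mul_assoc X]
      abel
    have : U * Y * (D + C * A⁻¹ * B) * (W * V) = U * (Y * (D + C * A⁻¹ * B) * W) * V := by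
      simp only [Matrix.mul_assoc]
    rw [this, key, Matrix.mul_add, Matrix.add_mul, hUV]

end System

/-! ### Minimality yields Bézout identities -/

theorem exists_left_inverse_of_rank_eq {ι : Type*} [Fintype ι] {n : ℕ} (M : Matrix ι (Fin n) F)
    (h : M.rank = n) : ∃ N : Matrix (Fin n) ι F, N * M = 1 := by
  classical
  have hinj : Function.Injective M.mulVecLin := by
    rw [← LinearMap.ker_eq_bot, ← Submodule.finrank_eq_zero]
    have := M.mulVecLin.finrank_range_add_finrank_ker
    rw [Module.finrank_fin_fun] at this
    have h' : Module.finrank F (LinearMap.range M.mulVecLin) = n := h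
    omega
  obtain ⟨g, hg⟩ := LinearMap.exists_leftInverse_of_injective M.mulVecLin
    (LinearMap.ker_eq_bot.mpr hinj)
  refine ⟨LinearMap.toMatrix' g, ?_⟩
  have := congrArg LinearMap.toMatrix' hg
  rw [LinearMap.toMatrix'_comp, ← Matrix.toLin'_apply', LinearMap.toMatrix'_toLin',
    LinearMap.toMatrix'_id] at this
  exact this

theorem evalAt_toRat {ι κ : Type*} (P : Matrix ι κ F[X]) :
    evalAt (toRat P) a = P.map (eval a) := by
  ext i j
  simp [evalAt, toRat, RatFunc.eval_algebraMap]

theorem eval_pencil {ι κ : Type*} (M₁ M₀ : Matrix ι κ F) :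
    (pencil M₁ M₀).map (eval a) = a • M₁ + M₀ := by
  ext i j
  simp only [pencil, Matrix.map_apply, Matrix.of_apply, eval_add, eval_mul, eval_C, eval_X,
    Matrix.add_apply, Matrix.smul_apply, smul_eq_mul]
  rw [mul_comm]

theorem evalAt_add {ι κ : Type*} {M N : Matrix ι κ (RatFunc F)} (hM : DefinedAt M a)
    (hN : DefinedAt N a) : evalAt (M + N) a = evalAt M a + evalAt N a := by
  ext i j
  exact RatFunc.eval_add (f := RingHom.id F) (a := a) (hM i j) (hN i j)

theorem definedAt_map_C {ι κ : Type*} (M : Matrix ι κ F) : DefinedAt (M.map RatFunc.C) a := by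
  intro i j
  simp

theorem evalAt_map_C {ι κ : Type*} (M : Matrix ι κ F) : evalAt (M.map RatFunc.C) a = M := by
  ext i j
  simp [evalAt]

/-- A matrix whose value at `a` has a left inverse has a left inverse defined at `a`. -/
theorem exists_bezout_left {n q : ℕ} {A : Matrix (Fin n) (Fin n) (RatFunc F)}
    {C : Matrix (Fin q) (Fin n) (RatFunc F)} (hA : DefinedAt A a) (hC : DefinedAt C a)
    (h : (Matrix.fromRows (evalAt A a) (evalAt C a)).rank = n) :
    ∃ (X : Matrix (Fin n) (Fin n) (RatFunc F)) (Y : Matrix (Fin n) (Fin q) (RatFunc F)),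
      DefinedAt X a ∧ DefinedAt Y a ∧ X * A + Y * C = 1 := by
  obtain ⟨N, hN⟩ := exists_left_inverse_of_rank_eq _ h
  rw [← Matrix.fromCols_toCols N, Matrix.fromCols_mul_fromRows] at hN
  have h1 := definedAt_map_C (a := a) N.toCols₁
  have h2 := definedAt_map_C (a := a) N.toCols₂
  -- The constant left inverse of the value at `a` produces a matrix whose value there is 1;
  -- dividing by this regular matrix gives the identity over the local ring.
  have hreg : RegularAt (N.toCols₁.map RatFunc.C * A + N.toCols₂.map RatFunc.C * C) a := by
    refine ⟨(h1.mul hA).add (h2.mul hC), ?_⟩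
    rw [evalAt_add (h1.mul hA) (h2.mul hC), evalAt_mul h1 hA, evalAt_mul h2 hC, evalAt_map_C,
      evalAt_map_C, hN]
    simp
  refine ⟨_, _, hreg.definedAt_inv.mul h1, hreg.definedAt_inv.mul h2, ?_⟩
  rw [Matrix.mul_assoc, Matrix.mul_assoc, ← Matrix.mul_add,
    Matrix.nonsing_inv_mul _ hreg.isUnit_det]

theorem exists_bezout_right {n r : ℕ} {A : Matrix (Fin n) (Fin n) (RatFunc F)}
    {B : Matrix (Fin n) (Fin r) (RatFunc F)} (hA : DefinedAt A a) (hB : DefinedAt B a)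
    (h : (Matrix.fromCols (evalAt A a) (evalAt B a)).rank = n) :
    ∃ (Z : Matrix (Fin n) (Fin n) (RatFunc F)) (W : Matrix (Fin r) (Fin n) (RatFunc F)),
      DefinedAt Z a ∧ DefinedAt W a ∧ A * Z + B * W = 1 := by
  have h' : (Matrix.fromRows (evalAt A.transpose a) (evalAt B.transpose a)).rank = n := by
    rw [← Matrix.rank_transpose, Matrix.transpose_fromCols] at h
    exact h
  obtain ⟨X, Y, hX, hY, hXY⟩ := exists_bezout_left (A := A.transpose) (C := B.transpose)
    (fun i j => hA j i) (fun i j => hB j i) h'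
  refine ⟨X.transpose, Y.transpose, fun i j => hX j i, fun i j => hY j i, ?_⟩
  have := congrArg Matrix.transpose hXY
  simpa using this

/-! ### Elementary divisors in terms of counts -/

theorem countP_natLe_succ (l : List ℕ) (k : ℕ) :
    l.countP (k + 1 ≤ ·) + l.count k = l.countP (k ≤ ·) := by
  induction l with
  | nil => simp
  | cons x l ih =>
    simp only [List.countP_cons, List.count_cons, decide_eq_true_eq, beq_iff_eq]
    split_ifs <;> omega

/-- Multiplicities are differences of consecutive upper counts. The threshold 0 is not needed
because every entry is positive. -/
theorem perm_iff_countP_le {l l' : List ℕ} (hl : ∀ x ∈ l, 1 ≤ x) (hl' : ∀ x ∈ l', 1 ≤ x) :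
    l.Perm l' ↔ ∀ k : ℕ, 1 ≤ k → l.countP (k ≤ ·) = l'.countP (k ≤ ·) := by
  refine ⟨fun h k _ => h.countP_eq _, fun h => List.perm_iff_count.mpr fun k => ?_⟩
  rcases Nat.eq_zero_or_pos k with rfl | hk
  · rw [List.count_eq_zero_of_not_mem fun h => by simpa using hl _ h,
      List.count_eq_zero_of_not_mem fun h => by simpa using hl' _ h]
  · have h1 := countP_natLe_succ l k
    have h2 := countP_natLe_succ l' k
    rw [h k hk, h (k + 1) (by omega)] at h1
    omega

theorem pow_X_sub_C_injective (a : F) : Function.Injective fun k : ℕ => (X - C a : F[X]) ^ k := by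
  intro k l h
  simpa using congrArg natDegree h

/-- Powers of X - a are distinguished by their degrees, so comparing divisor multisets means
comparing exponents. -/
theorem coe_map_pow_eq_iff {l l' : List ℤ} (f g : ℤ → ℕ) (hl : ∀ x ∈ l, 1 ≤ f x)
    (hl' : ∀ x ∈ l', 1 ≤ g x) :
    ((l.map fun k => (X - C a : F[X]) ^ f k : List F[X]) : Multiset F[X]) =
        (l'.map fun k => (X - C a : F[X]) ^ g k : List F[X]) ↔
      ∀ k : ℕ, 1 ≤ k → l.countP (fun x => k ≤ f x) = l'.countP (fun x => k ≤ g x) := by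
  have h1 : l.map (fun k => (X - C a : F[X]) ^ f k) = (l.map f).map ((X - C a : F[X]) ^ ·) := by
    simp
  have h2 : l'.map (fun k => (X - C a : F[X]) ^ g k) =
      (l'.map g).map ((X - C a : F[X]) ^ ·) := by
    simp
  rw [Multiset.coe_eq_coe, h1, h2, List.map_perm_map_iff (pow_X_sub_C_injective a),
    perm_iff_countP_le (by simpa using hl) (by simpa using hl')]
  simp only [List.countP_map]
  rfl

/-- Nonnegativity of the orders of `P` ensures that `toNat` sends its nonzero orders to genuine
positive exponents. -/
theorem poleElementaryDivisors_eq_iff {p m p' m' : ℕ} (G : Matrix (Fin p) (Fin m) (RatFunc F))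
    (P : Matrix (Fin p') (Fin m') F[X]) (hP : ∀ x ∈ invariantOrders (toRat P) a, 0 ≤ x) :
    poleElementaryDivisors G a = elementaryDivisors P a ↔
      ∀ k : ℤ, 1 ≤ k → (invariantOrders G a).countP (· ≤ -k) =
        (invariantOrders (toRat P) a).countP (k ≤ ·) := by
  have h1 : ∀ k : ℕ, 1 ≤ k →
      ((invariantOrders G a).filter (· < 0)).countP (fun x => k ≤ (-x).toNat) =
      (invariantOrders G a).countP (· ≤ -(k : ℤ)) := by
    intro k hk
    rw [List.countP_filter]
    refine List.countP_congr fun x _ => ?_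
    simp only [decide_eq_true_eq, Bool.and_eq_true]
    omega
  have h2 : ∀ k : ℕ, 1 ≤ k →
      ((invariantOrders (toRat P) a).filter (· ≠ 0)).countP (fun x => k ≤ x.toNat) =
      (invariantOrders (toRat P) a).countP ((k : ℤ) ≤ ·) := by
    intro k hk
    rw [List.countP_filter]
    refine List.countP_congr fun x _ => ?_
    simp only [decide_eq_true_eq, Bool.and_eq_true]
    omega
  rw [poleElementaryDivisors, elementaryDivisors, coe_map_pow_eq_iff]
  · constructor
    · intro h k hk
      lift k to ℕ using by omega
      have hk' : 1 ≤ k := by omega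
      rw [← h1 k hk', ← h2 k hk', h k hk']
    · intro h k hk
      rw [h1 k hk, h2 k hk, h k (by omega)]
  · intro x hx
    have := List.of_mem_filter hx
    simp only [decide_eq_true_eq] at this
    omega
  · intro x hx
    have h3 := List.of_mem_filter hx
    have h4 := hP x (List.mem_of_mem_filter hx)
    simp only [decide_eq_true_eq] at h3
    omega

theorem zeroElementaryDivisors_eq_iff {p m p' m' : ℕ} (G : Matrix (Fin p) (Fin m) (RatFunc F))
    (P : Matrix (Fin p') (Fin m') F[X]) (hP : ∀ x ∈ invariantOrders (toRat P) a, 0 ≤ x) :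
    zeroElementaryDivisors G a = elementaryDivisors P a ↔
      ∀ k : ℤ, 1 ≤ k → (invariantOrders G a).countP (k ≤ ·) =
        (invariantOrders (toRat P) a).countP (k ≤ ·) := by
  have h1 : ∀ k : ℕ, 1 ≤ k →
      ((invariantOrders G a).filter (0 < ·)).countP (fun x => k ≤ x.toNat) =
      (invariantOrders G a).countP ((k : ℤ) ≤ ·) := by
    intro k hk
    rw [List.countP_filter]
    refine List.countP_congr fun x _ => ?_
    simp only [decide_eq_true_eq, Bool.and_eq_true]
    omega
  have h2 : ∀ k : ℕ, 1 ≤ k →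
      ((invariantOrders (toRat P) a).filter (· ≠ 0)).countP (fun x => k ≤ x.toNat) =
      (invariantOrders (toRat P) a).countP ((k : ℤ) ≤ ·) := by
    intro k hk
    rw [List.countP_filter]
    refine List.countP_congr fun x _ => ?_
    simp only [decide_eq_true_eq, Bool.and_eq_true]
    omega
  rw [zeroElementaryDivisors, elementaryDivisors, coe_map_pow_eq_iff]
  · constructor
    · intro h k hk
      lift k to ℕ using by omega
      have hk' : 1 ≤ k := by omega
      rw [← h1 k hk', ← h2 k hk', h k hk']
    · intro h k hk
      rw [h1 k hk, h2 k hk, h k (by omega)]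
  · intro x hx
    have := List.of_mem_filter hx
    simp only [decide_eq_true_eq] at this
    omega
  · intro x hx
    have h3 := List.of_mem_filter hx
    have h4 := hP x (List.mem_of_mem_filter hx)
    simp only [decide_eq_true_eq] at h3
    omega

theorem countP_le_add_countP_succ_le (ν : List ℤ) (k : ℤ) :
    ν.countP (· ≤ k) + ν.countP (k + 1 ≤ ·) = ν.length := by
  induction ν with
  | nil => simp
  | cons x l ih =>
    simp only [List.countP_cons, List.length_cons, decide_eq_true_eq]
    split_ifs <;> omega

theorem isInvariantOrders_invariantOrders {p m : ℕ} (G : Matrix (Fin p) (Fin m) (RatFunc F))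
    (a : F) : IsInvariantOrders G a (invariantOrders G a) :=
  (exists_isInvariantOrders G a).choose_spec

/-- A matrix defined at `a` has count 0 at every negative level, in particular at -1. -/
theorem IsInvariantOrders.nonneg {p m : ℕ} {G : Matrix (Fin p) (Fin m) (RatFunc F)} {ν : List ℤ}
    (h : IsInvariantOrders G a ν) (hG : DefinedAt G a) : ∀ x ∈ ν, 0 ≤ x := by
  have h1 := (h.hasOrderCount (-1)).unique (hasOrderCount_of_definedAt hG (by norm_num))
  intro x hx
  have := List.countP_eq_zero.mp h1 x hx
  simp only [decide_eq_true_eq] at this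
  omega

/-! ### Linear system matrices -/

namespace LinearSystemMatrix

variable {n q r : ℕ} (L : LinearSystemMatrix F n q r)

theorem isUnit_det_toRat_stateMatrix : IsUnit (toRat L.stateMatrix).det := by
  have h : (toRat L.stateMatrix).det = algebraMap F[X] (RatFunc F) L.stateMatrix.det :=
    (RingHom.map_det _ _).symm
  rw [h, isUnit_iff_ne_zero, Ne, map_eq_zero_iff _ (RatFunc.algebraMap_injective F)]
  exact L.nonsingular

theorem toRat_toMatrix : toRat L.toMatrix =
    (Matrix.fromBlocks (toRat L.stateMatrix) (toRat (pencil L.B₁ L.B₀))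
      (-toRat (pencil L.C₁ L.C₀)) (toRat (pencil L.D₁ L.D₀))).submatrix
      finSumFinEquiv.symm finSumFinEquiv.symm := by
  have h : -toRat (pencil L.C₁ L.C₀) = toRat (-pencil L.C₁ L.C₀) := by
    ext i j
    simp [toRat]
  rw [h, toRat, toRat, toRat, toRat, toRat, ← Matrix.fromBlocks_map]
  rfl

variable {L}

theorem IsMinimalAt.exists_bezout (h : L.IsMinimalAt a) :
    ∃ (X : Matrix (Fin n) (Fin n) (RatFunc F)) (Y : Matrix (Fin n) (Fin q) (RatFunc F))
      (Z : Matrix (Fin n) (Fin n) (RatFunc F)) (W : Matrix (Fin r) (Fin n) (RatFunc F)),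
      DefinedAt X a ∧ DefinedAt Y a ∧ DefinedAt Z a ∧ DefinedAt W a ∧
      X * toRat L.stateMatrix + Y * toRat (pencil L.C₁ L.C₀) = 1 ∧
      toRat L.stateMatrix * Z + toRat (pencil L.B₁ L.B₀) * W = 1 := by
  obtain ⟨X, Y, hX, hY, hXY⟩ := exists_bezout_left (a := a) (definedAt_toRat L.stateMatrix)
    (definedAt_toRat (pencil L.C₁ L.C₀)) (by
      rw [evalAt_toRat, evalAt_toRat, stateMatrix, eval_pencil, eval_pencil]
      exact h.1)
  obtain ⟨Z, W, hZ, hW, hZW⟩ := exists_bezout_right (a := a) (definedAt_toRat L.stateMatrix)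
    (definedAt_toRat (pencil L.B₁ L.B₀)) (by
      rw [evalAt_toRat, evalAt_toRat, stateMatrix, eval_pencil, eval_pencil]
      exact h.2)
  exact ⟨X, Y, Z, W, hX, hY, hZ, hW, hXY, hZW⟩

/-- The zero structure of a minimal system matrix is that of its transfer function. -/
theorem IsMinimalAt.hasOrderCount_toMatrix (h : L.IsMinimalAt a) {ν : List ℤ}
    (hν : IsInvariantOrders L.transferFunction a ν) {k : ℤ} (hk : 0 ≤ k) :
    HasOrderCount (toRat L.toMatrix) a k (n + ν.countP (· ≤ k)) := by
  obtain ⟨X, Y, Z, W, hX, hY, hZ, hW, hXY, hZW⟩ := h.exists_bezout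
  rw [toRat_toMatrix]
  refine HasOrderCount.submatrix ⟨?_, ?_⟩ _ _
  · exact factorsScalar_fromBlocks L.isUnit_det_toRat_stateMatrix (definedAt_toRat _)
      (definedAt_toRat _) (definedAt_toRat _) hX hY hZ hW hXY hZW hk hν
  · exact lowRankMod_fromBlocks L.isUnit_det_toRat_stateMatrix (hν.hasOrderCount k).2

/-- The pole structure of the transfer function of a minimal system is the zero structure of its
state matrix. -/
theorem IsMinimalAt.countP_transferFunction (h : L.IsMinimalAt a) {ν μ : List ℤ}
    (hν : IsInvariantOrders L.transferFunction a ν)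
    (hμ : IsInvariantOrders (toRat L.stateMatrix) a μ) {k : ℤ} (hk : 1 ≤ k) :
    ν.countP (· ≤ -k) = μ.countP (k ≤ ·) := by
  obtain ⟨X, Y, Z, W, hX, hY, hZ, hW, hXY, hZW⟩ := h.exists_bezout
  have hiff := factorsScalar_transfer_iff (a := a) (D := toRat (pencil L.D₁ L.D₀))
    L.isUnit_det_toRat_stateMatrix (definedAt_toRat _)
    (definedAt_toRat _) (definedAt_toRat _) (definedAt_toRat _) hX hY hZ hW hXY hZW hk
  have h1 := hν.hasOrderCount (-k)
  have h2 := hμ.hasOrderCount_inv L.isUnit_det_toRat_stateMatrix k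
  exact le_antisymm (((hiff _).mp h1.1).le_of_lowRankMod h2.2)
    (((hiff _).mpr h2.1).le_of_lowRankMod h1.2)

/-- Equivalence at `a` of the two padded matrices amounts to equality of their counts, each shifted
by its identity block at levels k ≥ 0. -/
theorem isLinearizationAt_iff {p m s : ℕ} {L : LinearSystemMatrix F n (p + s) (m + s)}
    (h : L.IsMinimalAt a) {G : Matrix (Fin p) (Fin m) (RatFunc F)} {ν γ : List ℤ}
    (hν : IsInvariantOrders G a ν) (hγ : IsInvariantOrders L.transferFunction a γ) :
    L.IsLinearizationAt G a ↔
      ∀ k : ℤ, γ.countP (· ≤ k) = ν.countP (· ≤ k) + if 0 ≤ k then s else 0 := by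
  constructor
  · rintro ⟨-, s₁, s₂, hq, hr, heq⟩ k
    have h1 := heq.hasOrderCount ((hν.hasOrderCount k).diagId s₁)
    have h2 := ((hγ.hasOrderCount k).diagId s₂).submatrix (finCongr hq) (finCongr hr)
    have := h1.unique h2
    -- The size equation `hq` gives s₁ = s + s₂, so the two shifts differ by exactly s.
    split_ifs at this ⊢ <;> omega
  · intro hcount
    refine ⟨h, s, 0, rfl, rfl, equivalentAt_of_hasOrderCount fun k => ⟨_,
      (hν.hasOrderCount k).diagId s, ?_⟩⟩
    rw [← hcount]
    have h2 := ((hγ.hasOrderCount k).diagId 0).submatrix (finCongr (rfl : p + s = p + s + 0))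
      (finCongr (rfl : m + s = m + s + 0))
    simp only [ite_self, add_zero] at h2
    exact h2

end LinearSystemMatrix

end RatMat

end

/-! ### The equivalence with conditions (a), (b), (c) -/

open RatMat in
theorem theorem4p9 {F : Type*} [Field F] [IsAlgClosed F] {n p m s : ℕ}
    (G : Matrix (Fin p) (Fin m) (RatFunc F)) (lam0 : F)
    (L : RatMat.LinearSystemMatrix F n (p + s) (m + s)) (hmin : L.IsMinimalAt lam0) :
    L.IsLinearizationAt G lam0 ↔
      (RatMat.toRat L.toMatrix).rank = G.rank + n + s ∧
      RatMat.poleElementaryDivisors G lam0 = RatMat.elementaryDivisors L.stateMatrix lam0 ∧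
      RatMat.zeroElementaryDivisors G lam0 = RatMat.elementaryDivisors L.toMatrix lam0 := by
  have hν := isInvariantOrders_invariantOrders G lam0
  have hμ := isInvariantOrders_invariantOrders (toRat L.stateMatrix) lam0
  have hlam := isInvariantOrders_invariantOrders (toRat L.toMatrix) lam0
  -- The orders of the transfer function mediate between those of G, of the state matrix and of the
  -- system matrix.
  obtain ⟨γ, hγ⟩ := exists_isInvariantOrders L.transferFunction lam0
  rw [LinearSystemMatrix.isLinearizationAt_iff hmin hν hγ,
    poleElementaryDivisors_eq_iff _ _ (hμ.nonneg (definedAt_toRat _)),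
    zeroElementaryDivisors_eq_iff _ _ (hlam.nonneg (definedAt_toRat _)),
    ← hlam.2.1, ← hν.2.1]
  have hpole : ∀ k : ℤ, 1 ≤ k → _ := fun k hk => hmin.countP_transferFunction hγ hμ hk
  have hzero : ∀ k : ℤ, 0 ≤ k → _ := fun k hk =>
    (hlam.hasOrderCount k).unique (hmin.hasOrderCount_toMatrix hγ hk)
  generalize invariantOrders G lam0 = ν at *
  generalize invariantOrders (toRat L.stateMatrix) lam0 = μ at *
  generalize invariantOrders (toRat L.toMatrix) lam0 = l at *
  constructor
  · intro h
    have hlen : l.length = ν.length + n + s := by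
      obtain ⟨k₁, h1⟩ := exists_forall_le_countP_eq_length ν
      obtain ⟨k₂, h2⟩ := exists_forall_le_countP_eq_length l
      -- At a level above all orders each count is the full length, so the count identity becomes
      -- the rank identity.
      have h3 := hzero (max 0 (max k₁ k₂)) (by omega)
      rw [h, h1 _ (by omega), h2 _ (by omega), if_pos (by omega)] at h3
      omega
    refine ⟨hlen, fun k hk => ?_, fun k hk => ?_⟩
    · rw [← hpole k hk, h, if_neg (by omega), add_zero]
    · have h1 := countP_le_add_countP_succ_le ν (k - 1)
      have h2 := countP_le_add_countP_succ_le l (k - 1)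
      rw [hzero _ (by omega), h, if_pos (by omega)] at h2
      rw [sub_add_cancel] at h1 h2
      omega
  · rintro ⟨hlen, hp, hz⟩ k
    by_cases hk : 0 ≤ k
    -- For k ≥ 0 the equality of zero divisors is used at the threshold k + 1 ≥ 1, and the rank
    -- condition converts it back to counts at most k.
    · have h1 := countP_le_add_countP_succ_le ν k
      have h2 := countP_le_add_countP_succ_le l k
      rw [hzero _ hk, ← hz _ (by omega)] at h2
      rw [if_pos hk]
      omega
    -- For negative levels both counts equal the number of orders of the state matrix that are at
    -- least -k.
    · obtain ⟨k, rfl⟩ : ∃ j, k = -j := ⟨-k, by ring⟩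
      rw [if_neg hk, hp k (by omega), hpole k (by omega), add_zero]
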